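/- Let $G,\hbar,c,e,m_{e}>0$ denote Newton's constant, the reduced Planck constant, the speed of light, the elementary charge and the electron mass (Gaussian units), and put $\alpha=\frac{e^2}{\hbar c}$. Let $Z\in\mathbb N$, $Z\ge 1$, and $M>0$ satisfy $Z^2e^2\le GM^2$ (charge and mass of a subextremal or extremal Reissner--Weyl--Nordström black hole). With lengths in units of $\hbar/(m_ec)$ let $$f^2(r)=1-\frac{2GMm_e}{\hbar c}\frac1r+\frac{Gm_e^2}{\hbar c}\frac{Z^2e^2}{\hbar c}\frac1{r^2},\qquad r_-=\frac{GMm_e}{\hbar c}\Bigl(1-\sqrt{1-\tfrac{Z^2e^2}{GM^2}}\Bigr),$$ let $f>0$ be the positive square root of $f^2$ on $(0,r_-)$, and let $x\mapsto r(x)$, $(0,\infty)\to(0,r_-)$, be the inverse of the bijection $r\mapsto x=\int_0^r \frac{ds}{f^2(s)}$. For $k\in\mathbb Z\setminus\{0\}$ and $\mathrm{far}\in\mathbb R$ (the amplitude of the anomalous magnetic moment of the electron in units of the classical magnetic moment $\mu_{\rm class}=\frac{1}{4\pi}\frac{e^3}{m_ec^2}$) let $\widetilde K_k^{\rm far}$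 be the operator in $L^2((0,\infty),dx;\mathbb C^2)$ with domain $C_c^\infty((0,\infty);\mathbb C^2)$ given by $$\widetilde K_k^{\rm far}=\begin{pmatrix} f(r(x))-\frac{Z\alpha}{r(x)} & \Bigl[\frac{k}{r(x)}-\frac{Z\alpha^2\,\mathrm{far}}{4\pi r(x)^2}\Bigr]f(r(x))-\frac{d}{dx}\\[1ex] \Bigl[\frac{k}{r(x)}-\frac{Z\alpha^2\,\mathrm{far}}{4\pi r(x)^2}\Bigr]f(r(x))+\frac{d}{dx} & -f(r(x))-\frac{Z\alpha}{r(x)}\end{pmatrix}.$$ Put $\mathrm{far}_{\rm crit}=\frac32\frac{\sqrt G\,\hbar}{c}\Big/\mu_{\rm class}$. Then: 1. $\widetilde K_k^{\rm far}$ is essentially self-adjoint whenever $\mathrm{far}\ge \mathrm{far}_{\rm crit}$. 2. Suppose that the physical constants have their empirical values, in the sense that $\frac1{137.04}\le\frac{e^2}{\hbar c}\le\frac1{137.03}$ and $1.75\cdot10^{-45}\le \frac{Gm_e^2}{\hbar c}\le 1.80\cdot 10^{-45}$. Then $\mathrm{far}_{\rm crit}\approx 1.3\cdot10^{-18}$,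 precisely $|\mathrm{far}_{\rm crit}-1.3\cdot 10^{-18}|<0.05\cdot10^{-18}$; the operator $\widetilde K_k^{\rm far}$ is essentially self-adjoint for every $\mathrm{far}\ge 1.3\cdot10^{-18}$; and in particular it is essentially self-adjoint for the empirical value $\mathrm{far}\approx1$ of the electron's anomalous magnetic moment, i.e. for every $\mathrm{far}$ with $|\mathrm{far}-1|\le 0.005$. -/

import Mathlib

open Set MeasureTheory Topology Filter
open scoped ContDiff ENNReal

noncomputable section

namespace RWN

/-! ### Physical constants (Gaussian units) -/

/-- A system of values for Newton's constant `G`, the reduced Planck constant `hbar`, the speed of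
light `c`, the elementary charge `e` and the electron mass `me`, in any coherent system of
Gaussian units. -/
structure PhysicalConstants where
  G : ℝ
  hbar : ℝ
  c : ℝ
  e : ℝ
  me : ℝ
  G_pos : 0 < G
  hbar_pos : 0 < hbar
  c_pos : 0 < c
  e_pos : 0 < e
  me_pos : 0 < me

namespace PhysicalConstants

variable (C : PhysicalConstants)

/-- Sommerfeld's fine structure constant `e² / (ℏ c)`. -/
def alphaS : ℝ := C.e ^ 2 / (C.hbar * C.c)

/-- The classical magnetic moment of the electron, `e³ / (4 π mₑ c²)`. -/
def muClass : ℝ := 1 / (4 * Real.pi) * (C.e ^ 3 / (C.me * C.c ^ 2))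

/-- The threshold amplitude: `far * muClass ≥ (3/2) √G ℏ / c` iff `farCrit ≤ far`. -/
def farCrit : ℝ := 3 / 2 * (Real.sqrt C.G * C.hbar / C.c) / C.muClass

/-- The constants have their empirical values, up to an explicit tolerance. Only the two
(unit-independent) dimensionless numbers `e²/(ℏc) ≈ 1/137.036` and
`G mₑ²/(ℏc) ≈ 1.75 ⋅ 10⁻⁴⁵` (also quoted as `1.79 ⋅ 10⁻⁴⁵`) are constrained. -/
def IsEmpirical : Prop :=
  C.alphaS ∈ Icc (1 / 137.04 : ℝ) (1 / 137.03) ∧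
    C.G * C.me ^ 2 / (C.hbar * C.c) ∈ Icc (1.75e-45 : ℝ) 1.8e-45

end PhysicalConstants

/-! ### The black hole -/

/-- The parameters of a subextremal or extremal Reissner-Weyl-Nordström black hole:
charge `Z e` and ADM mass `M`, with `Z² e² ≤ G M²`. -/
structure BlackHole (C : PhysicalConstants) where
  Z : ℕ
  M : ℝ
  Z_pos : 1 ≤ Z
  M_pos : 0 < M
  charge_le : (Z : ℝ) ^ 2 * C.e ^ 2 ≤ C.G * M ^ 2

namespace BlackHole

variable {C : PhysicalConstants} (B : BlackHole C)

/-- `f²(r)`, for the area radius `r` in units of the reduced Compton wave length of the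
electron. -/
def fSq (r : ℝ) : ℝ :=
  1 - 2 * (C.G * B.M * C.me / (C.hbar * C.c)) * (1 / r)
    + C.G * C.me ^ 2 / (C.hbar * C.c) * ((B.Z : ℝ) ^ 2 * C.e ^ 2 / (C.hbar * C.c)) * (1 / r ^ 2)

/-- The positive square root `f(r)`. -/
def f (r : ℝ) : ℝ := Real.sqrt (B.fSq r)

/-- The outer horizon radius. -/
def rPlus : ℝ :=
  C.G * B.M * C.me / (C.hbar * C.c) *
    (1 + Real.sqrt (1 - (B.Z : ℝ) ^ 2 * C.e ^ 2 / (C.G * B.M ^ 2)))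

/-- The inner horizon radius (equal to `rPlus` in the extremal case). -/
def rMinus : ℝ :=
  C.G * B.M * C.me / (C.hbar * C.c) *
    (1 - Real.sqrt (1 - (B.Z : ℝ) ^ 2 * C.e ^ 2 / (C.G * B.M ^ 2)))

/-- The variable `x` as a function of `r ∈ (0, r₋)`: `dx/dr = 1 / f²(r)`, and `x = 0` when
`r = 0`. -/
def tortoise (r : ℝ) : ℝ := ∫ s in (0 : ℝ)..r, 1 / B.fSq s

/-- The inverse `x ↦ r(x)`, `(0, ∞) → (0, r₋)`, of the change of variables `r ↦ x`. -/
def areaRadius (x : ℝ) : ℝ := Function.invFunOn B.tortoise (Ioo 0 B.rMinus) x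

/-! Basic facts: `r ↦ x` is a bijection of `(0, r₋)` onto `(0, ∞)`, with continuous inverse. -/

lemma sqrt_lt_one : Real.sqrt (1 - (B.Z : ℝ) ^ 2 * C.e ^ 2 / (C.G * B.M ^ 2)) < 1 := by
  have hZ : (0 : ℝ) < B.Z := by exact_mod_cast B.Z_pos
  have := C.G_pos
  have := C.e_pos
  have := B.M_pos
  rw [Real.sqrt_lt' one_pos]
  have : 0 < (B.Z : ℝ) ^ 2 * C.e ^ 2 / (C.G * B.M ^ 2) := by positivity
  linarith

lemma mass_pos : 0 < C.G * B.M * C.me / (C.hbar * C.c) := by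
  have := C.G_pos
  have := C.hbar_pos
  have := C.c_pos
  have := C.me_pos
  have := B.M_pos
  positivity

lemma rMinus_pos : 0 < B.rMinus :=
  mul_pos B.mass_pos (by linarith [B.sqrt_lt_one])

lemma rMinus_le_rPlus : B.rMinus ≤ B.rPlus := by
  unfold rMinus rPlus
  have := B.mass_pos
  gcongr
  linarith [Real.sqrt_nonneg (1 - (B.Z : ℝ) ^ 2 * C.e ^ 2 / (C.G * B.M ^ 2))]

lemma fSq_eq {r : ℝ} (hr : r ≠ 0) :
    B.fSq r = (B.rPlus - r) * (B.rMinus - r) / r ^ 2 := by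
  have h1 := C.G_pos
  have h2 := C.hbar_pos
  have h3 := C.c_pos
  have h4 := B.M_pos
  have hq : 0 ≤ 1 - (B.Z : ℝ) ^ 2 * C.e ^ 2 / (C.G * B.M ^ 2) := by
    rw [sub_nonneg, div_le_one (by positivity)]
    exact B.charge_le
  have hs := Real.sq_sqrt hq
  unfold fSq rPlus rMinus
  set s := Real.sqrt (1 - (B.Z : ℝ) ^ 2 * C.e ^ 2 / (C.G * B.M ^ 2))
  have hp : C.G * C.me ^ 2 / (C.hbar * C.c) * ((B.Z : ℝ) ^ 2 * C.e ^ 2 / (C.hbar * C.c))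
      = (C.G * B.M * C.me / (C.hbar * C.c)) ^ 2 * (1 - s ^ 2) := by
    rw [hs]
    field_simp
    ring
  rw [hp]
  field_simp
  ring

lemma fSq_pos {r : ℝ} (hr : r ∈ Ioo 0 B.rMinus) : 0 < B.fSq r := by
  rw [B.fSq_eq hr.1.ne']
  have h1 : 0 < B.rMinus - r := by linarith [hr.2]
  have h2 : 0 < B.rPlus - r := by linarith [B.rMinus_le_rPlus]
  have := hr.1
  positivity

lemma continuousOn_fSq : ContinuousOn B.fSq (Ioo 0 B.rMinus) := by
  intro r hr
  have : r ≠ 0 := hr.1.ne'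
  unfold fSq
  apply ContinuousAt.continuousWithinAt
  fun_prop (disch := positivity)

lemma tortoise_eq (r : ℝ) :
    B.tortoise r = ∫ s in (0 : ℝ)..r, s ^ 2 / ((B.rPlus - s) * (B.rMinus - s)) := by
  unfold tortoise
  apply intervalIntegral.integral_congr_ae
  have : ∀ᵐ s : ℝ, s ≠ 0 := by simp [ae_iff]
  filter_upwards [this] with s hs _
  rw [B.fSq_eq hs, one_div_div]

lemma continuousOn_density :
    ContinuousOn (fun s => s ^ 2 / ((B.rPlus - s) * (B.rMinus - s))) (Iio B.rMinus) := by
  intro s hs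
  have h1 : 0 < B.rMinus - s := sub_pos.2 hs
  have h2 : 0 < B.rPlus - s := by linarith [B.rMinus_le_rPlus]
  apply ContinuousAt.continuousWithinAt
  have := (mul_pos h2 h1).ne'
  fun_prop (disch := assumption)

lemma hasDerivAt_tortoise {r : ℝ} (hr : r ∈ Ico 0 B.rMinus) :
    HasDerivAt B.tortoise (r ^ 2 / ((B.rPlus - r) * (B.rMinus - r))) r := by
  rw [show B.tortoise = _ from funext B.tortoise_eq]
  refine intervalIntegral.integral_hasDerivAt_right ?_ ?_ ?_
  · refine (B.continuousOn_density.mono ?_).intervalIntegrable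
    rw [uIcc_of_le hr.1]
    exact fun s hs => lt_of_le_of_lt hs.2 hr.2
  · exact B.continuousOn_density.stronglyMeasurableAtFilter isOpen_Iio r hr.2
  · exact B.continuousOn_density.continuousAt (isOpen_Iio.mem_nhds hr.2)

lemma strictMonoOn_tortoise : StrictMonoOn B.tortoise (Ico 0 B.rMinus) := by
  refine strictMonoOn_of_deriv_pos (convex_Ico _ _)
    (fun r hr => (B.hasDerivAt_tortoise hr).continuousAt.continuousWithinAt) ?_
  intro r hr
  rw [interior_Ico] at hr
  rw [(B.hasDerivAt_tortoise ⟨hr.1.le, hr.2⟩).deriv]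
  have h1 : 0 < B.rMinus - r := by linarith [hr.2]
  have h2 : 0 < B.rPlus - r := by linarith [B.rMinus_le_rPlus]
  have := hr.1
  positivity

lemma tendsto_tortoise : Tendsto B.tortoise (𝓝[<] B.rMinus) atTop := by
  have hm := B.rMinus_pos
  have hp : 0 < B.rPlus := hm.trans_le B.rMinus_le_rPlus
  set K : ℝ := (B.rMinus / 2) ^ 2 / B.rPlus with hK
  have hK0 : 0 < K := by positivity
  have hd : ∀ r ∈ Ico (B.rMinus / 2) B.rMinus,
      HasDerivAt (fun r => B.tortoise r + K * Real.log (B.rMinus - r))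
        (r ^ 2 / ((B.rPlus - r) * (B.rMinus - r)) + K * (-1 / (B.rMinus - r))) r := by
    intro r hr
    have h1 : B.rMinus - r ≠ 0 := by linarith [hr.2]
    exact (B.hasDerivAt_tortoise ⟨by linarith [hr.1], hr.2⟩).add
      ((((hasDerivAt_id' r).const_sub B.rMinus).log h1).const_mul K)
  have hmono : MonotoneOn (fun r => B.tortoise r + K * Real.log (B.rMinus - r))
      (Ico (B.rMinus / 2) B.rMinus) := by
    refine monotoneOn_of_deriv_nonneg (convex_Ico _ _)
      (fun r hr => (hd r hr).continuousAt.continuousWithinAt)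
      (fun r hr => (hd r (interior_subset hr)).differentiableAt.differentiableWithinAt) ?_
    intro r hr
    have hr := interior_subset hr
    rw [(hd r hr).deriv]
    have h1 : 0 < B.rMinus - r := by linarith [hr.2]
    have h2 : 0 < B.rPlus - r := by linarith [B.rMinus_le_rPlus]
    have h3 : K ≤ r ^ 2 / (B.rPlus - r) := by
      rw [hK]
      gcongr
      · exact hr.1
      · linarith [hr.1]
    have h4 : r ^ 2 / ((B.rPlus - r) * (B.rMinus - r)) + K * (-1 / (B.rMinus - r))
        = (r ^ 2 / (B.rPlus - r) - K) / (B.rMinus - r) := by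
      field_simp
      ring
    rw [h4]
    exact div_nonneg (sub_nonneg.2 h3) h1.le
  set A := B.tortoise (B.rMinus / 2) + K * Real.log (B.rMinus - B.rMinus / 2) with hA
  have hlog : Tendsto (fun r => A + K * -Real.log (B.rMinus - r)) (𝓝[<] B.rMinus) atTop := by
    refine tendsto_atTop_add_const_left _ _ (Tendsto.const_mul_atTop hK0 ?_)
    refine tendsto_neg_atBot_atTop.comp (Real.tendsto_log_nhdsGT_zero.comp ?_)
    refine tendsto_nhdsWithin_iff.2 ⟨?_, ?_⟩
    · have : Tendsto (fun r => B.rMinus - r) (𝓝 B.rMinus) (𝓝 (B.rMinus - B.rMinus)) :=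
        (continuous_const.sub continuous_id).tendsto _
      rw [sub_self] at this
      exact this.mono_left nhdsWithin_le_nhds
    · filter_upwards [self_mem_nhdsWithin] with r hr using sub_pos.2 (mem_Iio.1 hr)
  refine tendsto_atTop_mono' _ ?_ hlog
  have hmem : Ico (B.rMinus / 2) B.rMinus ∈ 𝓝[<] B.rMinus := Ico_mem_nhdsLT (by linarith)
  filter_upwards [hmem] with r hr
  have := hmono ⟨le_rfl, by linarith⟩ hr hr.1
  simp only at this
  linarith

lemma tortoise_zero : B.tortoise 0 = 0 := by simp [tortoise]

lemma image_tortoise : B.tortoise '' Ioo 0 B.rMinus = Ioi 0 := by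
  have hm := B.rMinus_pos
  apply Subset.antisymm
  · rintro _ ⟨r, hr, rfl⟩
    have := B.strictMonoOn_tortoise ⟨le_rfl, hm⟩ ⟨hr.1.le, hr.2⟩ hr.1
    rwa [tortoise_zero] at this
  · intro x hx
    have hx : 0 < x := hx
    obtain ⟨b, hb, hb0, hbm⟩ := ((B.tendsto_tortoise.eventually_ge_atTop (x + 1)).and
      (Ioo_mem_nhdsLT hm)).exists
    have hc : ContinuousOn B.tortoise (Icc 0 b) := fun r hr =>
      (B.hasDerivAt_tortoise ⟨hr.1, hr.2.trans_lt hbm⟩).continuousAt.continuousWithinAt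
    obtain ⟨r, hr, hrx⟩ := intermediate_value_Icc hb0.le hc
      (show x ∈ Icc (B.tortoise 0) (B.tortoise b) by
        rw [tortoise_zero]; exact ⟨hx.le, by linarith⟩)
    refine ⟨r, ⟨lt_of_le_of_ne hr.1 ?_, hr.2.trans_lt hbm⟩, hrx⟩
    rintro rfl
    rw [tortoise_zero] at hrx
    exact hx.ne hrx

lemma areaRadius_mem {x : ℝ} (hx : 0 < x) : B.areaRadius x ∈ Ioo 0 B.rMinus :=
  Function.invFunOn_mem (B.image_tortoise.symm.subset hx)

lemma tortoise_areaRadius {x : ℝ} (hx : 0 < x) : B.tortoise (B.areaRadius x) = x :=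
  Function.invFunOn_eq (B.image_tortoise.symm.subset hx)

lemma areaRadius_tortoise {r : ℝ} (hr : r ∈ Ioo 0 B.rMinus) :
    B.areaRadius (B.tortoise r) = r := by
  have hx : 0 < B.tortoise r := by
    have : B.tortoise r ∈ Ioi (0 : ℝ) := B.image_tortoise ▸ mem_image_of_mem _ hr
    exact this
  exact (B.strictMonoOn_tortoise.mono Ioo_subset_Ico_self).injOn (B.areaRadius_mem hx) hr
    (B.tortoise_areaRadius hx)

lemma strictMonoOn_areaRadius : StrictMonoOn B.areaRadius (Ioi 0) := by
  intro x hx y hy hxy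
  rw [← (B.strictMonoOn_tortoise.mono Ioo_subset_Ico_self).lt_iff_lt
    (B.areaRadius_mem hx) (B.areaRadius_mem hy), B.tortoise_areaRadius hx,
    B.tortoise_areaRadius hy]
  exact hxy

lemma continuousAt_areaRadius {x : ℝ} (hx : 0 < x) : ContinuousAt B.areaRadius x := by
  refine B.strictMonoOn_areaRadius.continuousAt_of_image_mem_nhds (Ioi_mem_nhds hx) ?_
  refine mem_of_superset (isOpen_Ioo.mem_nhds (B.areaRadius_mem hx)) ?_
  intro r hr
  refine ⟨B.tortoise r, ?_, B.areaRadius_tortoise hr⟩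
  exact B.image_tortoise ▸ mem_image_of_mem _ hr

/-! ### The radial Dirac operator -/

/-- The coefficient `a(x) = f(r(x))`. -/
def a (x : ℝ) : ℝ := B.f (B.areaRadius x)

/-- The coefficient `b(x) = Z α / r(x)`. -/
def b (x : ℝ) : ℝ := B.Z * C.alphaS * (1 / B.areaRadius x)

/-- The coefficient `c(x) = f(r(x)) / r(x)`. -/
def c (x : ℝ) : ℝ := 1 / B.areaRadius x * B.f (B.areaRadius x)

/-- The coefficient `d(x) = Z α² f(r(x)) / (4 π r(x)²)`. -/
def d (x : ℝ) : ℝ :=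
  B.Z * C.alphaS ^ 2 * (1 / (4 * Real.pi)) * (1 / B.areaRadius x ^ 2) * B.f (B.areaRadius x)

end BlackHole

/-- The value space of two-component radial wave functions. -/
abbrev Spinor : Type := EuclideanSpace ℂ (Fin 2)

/-- The Hilbert space `L²((0, ∞), dx; ℂ²)`. -/
abbrev RadialHilbertSpace : Type := Lp Spinor 2 (volume.restrict (Ioi (0 : ℝ)))

/-- The open half line `(0, ∞)`. -/
def halfLine : TopologicalSpace.Opens ℝ := ⟨Ioi 0, isOpen_Ioi⟩

/-- `C_c^∞((0, ∞); ℂ²)`: smooth functions with compact support inside the open half line. -/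
abbrev RadialTestFunction : Type := TestFunction halfLine Spinor ⊤

namespace BlackHole

variable {C : PhysicalConstants} (B : BlackHole C)

/-- The differential expression
`K̃ g = ((a - b) g₁ + (k c - far d) g₂ - g₂', (k c - far d) g₁ + g₁' + (-a - b) g₂)`. -/
def diracExpr (k : ℤ) (far : ℝ) (g : ℝ → Spinor) (x : ℝ) : Spinor :=
  !₂[((B.a x - B.b x : ℝ) : ℂ) * g x 0
        + (((k * B.c x - far * B.d x : ℝ) : ℂ) * g x 1 - deriv g x 1),
      (((k * B.c x - far * B.d x : ℝ) : ℂ) * g x 0 + deriv g x 0)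
        + ((-B.a x - B.b x : ℝ) : ℂ) * g x 1]

lemma continuousAt_f {r : ℝ} (hr : r ∈ Ioo 0 B.rMinus) : ContinuousAt B.f r :=
  (B.continuousOn_fSq.continuousAt (isOpen_Ioo.mem_nhds hr)).sqrt

lemma continuousAt_a {x : ℝ} (hx : 0 < x) : ContinuousAt B.a x :=
  ContinuousAt.comp (B.continuousAt_f (B.areaRadius_mem hx)) (B.continuousAt_areaRadius hx)

lemma continuousAt_b {x : ℝ} (hx : 0 < x) : ContinuousAt B.b x :=
  continuousAt_const.mul
    (continuousAt_const.div (B.continuousAt_areaRadius hx) (B.areaRadius_mem hx).1.ne')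

lemma continuousAt_c {x : ℝ} (hx : 0 < x) : ContinuousAt B.c x :=
  (continuousAt_const.div (B.continuousAt_areaRadius hx) (B.areaRadius_mem hx).1.ne').mul
    (B.continuousAt_a hx)

lemma continuousAt_d {x : ℝ} (hx : 0 < x) : ContinuousAt B.d x :=
  (continuousAt_const.mul (continuousAt_const.div ((B.continuousAt_areaRadius hx).pow 2)
    (pow_ne_zero 2 (B.areaRadius_mem hx).1.ne'))).mul (B.continuousAt_a hx)

lemma continuous_deriv_test (φ : RadialTestFunction) : Continuous (deriv φ) :=
  φ.contDiff.continuous_deriv (by exact_mod_cast le_top)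

lemma tsupport_diracExpr (k : ℤ) (far : ℝ) (φ : RadialTestFunction) :
    tsupport (B.diracExpr k far φ) ⊆ tsupport φ := by
  refine closure_minimal ?_ (isClosed_tsupport _)
  intro x hx
  by_contra hn
  apply hx
  have h1 : φ x = 0 := image_eq_zero_of_notMem_tsupport hn
  have h2 : deriv φ x = 0 := by
    by_contra h
    exact hn (support_deriv_subset h)
  ext i
  fin_cases i <;> simp [diracExpr, h1, h2]

lemma continuous_diracExpr (k : ℤ) (far : ℝ) (φ : RadialTestFunction) :
    Continuous (B.diracExpr k far φ) := by
  refine continuous_of_tsupport fun x hx => ?_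
  have hx : 0 < x := φ.tsupport_subset (B.tsupport_diracExpr k far φ hx)
  have ha := B.continuousAt_a hx
  have hb := B.continuousAt_b hx
  have hc := B.continuousAt_c hx
  have hd := B.continuousAt_d hx
  have hφ : ContinuousAt φ x := φ.continuous.continuousAt
  have hφ' : ContinuousAt (deriv φ) x := (continuous_deriv_test φ).continuousAt
  have p : ∀ (i : Fin 2) {g : ℝ → Spinor}, ContinuousAt g x → ContinuousAt (fun y => g y i) x :=
    fun i g hg => (PiLp.continuous_apply 2 _ i).continuousAt.comp hg
  have hu : ContinuousAt (fun y => ((B.a y - B.b y : ℝ) : ℂ)) x :=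
    Complex.continuous_ofReal.continuousAt.comp (ha.sub hb)
  have hv : ContinuousAt (fun y => ((k * B.c y - far * B.d y : ℝ) : ℂ)) x :=
    Complex.continuous_ofReal.continuousAt.comp
      ((continuousAt_const.mul hc).sub (continuousAt_const.mul hd))
  have hw : ContinuousAt (fun y => ((-B.a y - B.b y : ℝ) : ℂ)) x :=
    Complex.continuous_ofReal.continuousAt.comp (ha.neg.sub hb)
  unfold diracExpr
  refine (PiLp.continuous_toLp 2 _).continuousAt.comp (continuousAt_pi.2 fun i => ?_)
  fin_cases i
  · exact (hu.mul (p 0 hφ)).add ((hv.mul (p 1 hφ)).sub (p 1 hφ'))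
  · exact ((hv.mul (p 0 hφ)).add (p 0 hφ')).add (hw.mul (p 1 hφ))

lemma memLp_diracExpr (k : ℤ) (far : ℝ) (φ : RadialTestFunction) :
    MemLp (B.diracExpr k far φ) 2 (volume.restrict (Ioi (0 : ℝ))) :=
  (B.continuous_diracExpr k far φ).memLp_of_hasCompactSupport
    (φ.hasCompactSupport.mono' ((subset_tsupport _).trans (B.tsupport_diracExpr k far φ)))

lemma diracExpr_add (k : ℤ) (far : ℝ) (φ ψ : RadialTestFunction) :
    B.diracExpr k far (φ + ψ : RadialTestFunction)
      = B.diracExpr k far φ + B.diracExpr k far ψ := by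
  funext x
  have h : deriv (φ + ψ : RadialTestFunction) x = deriv φ x + deriv ψ x :=
    deriv_add (φ.contDiff.differentiable (by simp) x) (ψ.contDiff.differentiable (by simp) x)
  have h0 : (φ + ψ : RadialTestFunction) x = φ x + ψ x := rfl
  ext i
  fin_cases i <;> simp only [diracExpr, Pi.add_apply, h, h0] <;> simp <;> ring

lemma diracExpr_smul (k : ℤ) (far : ℝ) (z : ℂ) (φ : RadialTestFunction) :
    B.diracExpr k far (z • φ : RadialTestFunction) = z • B.diracExpr k far φ := by
  funext x
  have h : deriv (z • φ : RadialTestFunction) x = z • deriv φ x :=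
    deriv_const_smul z (φ.contDiff.differentiable (by simp) x)
  have h0 : (z • φ : RadialTestFunction) x = z • φ x := rfl
  ext i
  fin_cases i <;> simp only [diracExpr, Pi.smul_apply, h, h0] <;> simp <;> ring

/-- The action of the differential expression on test functions, with values in `L²`. -/
def diracOnTest (k : ℤ) (far : ℝ) : RadialTestFunction →ₗ[ℂ] RadialHilbertSpace where
  toFun φ := (B.memLp_diracExpr k far φ).toLp
  map_add' φ ψ := by
    rw [← MemLp.toLp_add]
    exact MemLp.toLp_congr _ _ (by rw [diracExpr_add])
  map_smul' z φ := by
    rw [RingHom.id_apply, ← MemLp.toLp_const_smul]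
    exact MemLp.toLp_congr _ _ (by rw [diracExpr_smul])

end BlackHole

lemma memLp_test (φ : RadialTestFunction) : MemLp φ 2 (volume.restrict (Ioi (0 : ℝ))) :=
  φ.continuous.memLp_of_hasCompactSupport φ.hasCompactSupport

/-- The inclusion of the test functions into `L²`. -/
def testToL2 : RadialTestFunction →ₗ[ℂ] RadialHilbertSpace where
  toFun φ := (memLp_test φ).toLp
  map_add' _ _ := rfl
  map_smul' _ _ := rfl

lemma testToL2_injective : Function.Injective testToL2 := by
  intro φ ψ h
  have h : (φ : ℝ → Spinor) =ᵐ[volume.restrict (Ioi (0 : ℝ))] ψ :=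
    (MemLp.toLp_eq_toLp_iff (memLp_test φ) (memLp_test ψ)).1 h
  have h := Measure.eqOn_open_of_ae_eq h isOpen_Ioi φ.continuous.continuousOn
    ψ.continuous.continuousOn
  ext1 x
  by_cases hx : x ∈ Ioi (0 : ℝ)
  · exact h hx
  · rw [image_eq_zero_of_notMem_tsupport fun h' => hx (φ.tsupport_subset h'),
      image_eq_zero_of_notMem_tsupport fun h' => hx (ψ.tsupport_subset h')]

/-- The radial Dirac operator `K̃_k^far` in `L²((0, ∞); ℂ²)`, with its minimal domain
`C_c^∞((0, ∞); ℂ²)`. -/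
def Ktilde {C : PhysicalConstants} (B : BlackHole C) (k : ℤ) (far : ℝ) :
    RadialHilbertSpace →ₗ.[ℂ] RadialHilbertSpace where
  domain := LinearMap.range testToL2
  toFun := B.diracOnTest k far ∘ₗ
    (LinearEquiv.ofInjective testToL2 testToL2_injective).symm.toLinearMap

lemma Ktilde_apply {C : PhysicalConstants} (B : BlackHole C) (k : ℤ) (far : ℝ)
    (φ : RadialTestFunction) :
    Ktilde B k far ⟨testToL2 φ, LinearMap.mem_range_self _ φ⟩ = B.diracOnTest k far φ := by
  have h : (LinearEquiv.ofInjective testToL2 testToL2_injective).symm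
      ⟨testToL2 φ, LinearMap.mem_range_self _ φ⟩ = φ :=
    (LinearEquiv.symm_apply_eq _).2 (Subtype.ext rfl)
  exact congrArg (B.diracOnTest k far) h

/-- A densely defined operator is essentially self-adjoint if it is closable and its closure is
self-adjoint. -/
def IsEssentiallySelfAdjoint {H : Type*} [NormedAddCommGroup H] [InnerProductSpace ℂ H]
    [CompleteSpace H] (A : H →ₗ.[ℂ] H) : Prop :=
  Dense (A.domain : Set H) ∧ A.IsClosable ∧ IsSelfAdjoint A.closure

end RWN

end

/-! A densely defined symmetric operator is essentially self-adjoint as soon as its adjoint is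
symmetric. Here the adjoint is the maximal operator: by du Bois-Reymond its domain consists of
locally absolutely continuous spinors `g` on which it acts by the Dirac expression
(`exists_isDiracPair_of_adjoint`). By the Lagrange identity, its symmetry means that the form `conj
g₀ * h₁ - conj g₁ * h₀` vanishes at both ends of `(0, ∞)`.

At `∞` this is automatic: the form is integrable and so is its derivative. At `0`, write `v = k c -
far d` and let `V` be a primitive of `v`. The components solve `g₁' = v g₁ + q₁` and `g₀' = -v g₀ +
q₀`, where `q₁`, `q₀` are integrable at `0` because `a` and `b` are square integrable there. Near
`0` the magnetic moment term dominates and `v ≤ 0`, so `g₀` stays bounded. If moreover `exp V` is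
not square integrable at `0`, then `g₁` must tend to `0`, and the form vanishes.

The threshold comes from this non-integrability. Let `m = Z α² / (4 π)` and `R = √(r₊ r₋)`. As `r →
0`, `f ~ R / r` and `dx ~ r² / R² dr`, so `exp V` behaves like `r ^ (-far m / R)` and `exp (2 V) dx`
like `r ^ (2 - 2 far m / R) dr`. This diverges exactly when `far m ≥ (3/2) R`, that is, when `far ≥
farCrit` (`not_integrableOn_exp_offDiagPrimitive`). The numerical claims follow from `farCrit² α³ =
36 π² G mₑ² / (ℏ c)`. -/

/-! ### Essential self-adjointness from symmetry of the adjoint -/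

namespace LinearPMap

variable {H : Type*} [NormedAddCommGroup H] [InnerProductSpace ℂ H] [CompleteSpace H]

open scoped InnerProductSpace

/-- A vector of `H × H` that is annihilated by everything orthogonal to a subspace lies in the
closure of that subspace. -/
lemma mem_closure_of_forall_orthogonal (g : Submodule ℂ (H × H)) (p : H × H)
    (h : ∀ y z : H, (∀ q ∈ g, ⟪y, q.1⟫_ℂ + ⟪z, q.2⟫_ℂ = 0) → ⟪y, p.1⟫_ℂ + ⟪z, p.2⟫_ℂ = 0) :
    p ∈ g.topologicalClosure := by
  -- `H × H` carries the sup norm. The double orthogonal complement is taken in its Hilbert space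
  -- version `WithLp 2 (H × H)`, and the closure is carried back by continuity of `e`.
  set e := WithLp.linearEquiv 2 ℂ (H × H) with he
  set K : Submodule ℂ (WithLp 2 (H × H)) := g.comap e.toLinearMap with hK
  have hmem : e.symm p ∈ Kᗮᗮ := by
    rw [Submodule.mem_orthogonal]
    intro u hu
    rw [Submodule.mem_orthogonal'] at hu
    have := h u.fst u.snd fun q hq => by
      have := hu (e.symm q) (by simpa [hK] using hq)
      simpa [WithLp.prod_inner_apply, he] using this
    simpa [WithLp.prod_inner_apply, he] using this
  rw [Submodule.orthogonal_orthogonal_eq_closure] at hmem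
  have hc : Continuous e := WithLp.prod_continuous_ofLp 2 H H
  have h2 : e (e.symm p) ∈ _root_.closure (g : Set (H × H)) :=
    map_mem_closure hc hmem fun q hq => hq
  rwa [LinearEquiv.apply_symm_apply] at h2

/-- A densely defined symmetric operator whose adjoint is symmetric is essentially
self-adjoint. -/
theorem isEssentiallySelfAdjoint_of_adjoint_symmetric {T : H →ₗ.[ℂ] H}
    (hd : Dense (T.domain : Set H)) (hs : T.IsFormalAdjoint T)
    (ha : T.adjoint.IsFormalAdjoint T.adjoint) : RWN.IsEssentiallySelfAdjoint T := by
  have hle : T ≤ T.adjoint := hs.le_adjoint hd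
  have hcl : T.adjoint.IsClosed := adjoint_isClosed hd
  have hT : T.IsClosable := hcl.isClosable.leIsClosable hle
  have hgraph : T.closure.graph = T.adjoint.graph := by
    rw [← hT.graph_closure_eq_closure_graph]
    apply le_antisymm
    · exact Submodule.topologicalClosure_minimal _ (le_graph_of_le hle) hcl
    · intro p hp
      obtain ⟨x, hx1, hx2⟩ := (mem_graph_iff _).1 hp
      refine mem_closure_of_forall_orthogonal _ _ fun y z hyz => ?_
      -- Orthogonality of `(y, z)` to the graph of `T` says that `z` is in the domain of the
      -- adjoint, with image `-y`. Symmetry of the adjoint then makes `(y, z)` orthogonal to the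
      -- graph of the adjoint too.
      have hyz' : ∀ t : T.domain, ⟪-y, (t : H)⟫_ℂ = ⟪z, T t⟫_ℂ := fun t => by
        have := hyz (t, T t) (T.mem_graph t)
        rw [inner_neg_left, neg_eq_iff_add_eq_zero]
        exact this
      have hz : z ∈ T.adjoint.domain := mem_adjoint_domain_of_exists _ ⟨_, hyz'⟩
      have hTz : T.adjoint ⟨z, hz⟩ = -y := adjoint_apply_eq hd _ hyz'
      have := ha ⟨z, hz⟩ x
      rw [hTz, inner_neg_left, neg_eq_iff_add_eq_zero] at this
      rw [← hx1, ← hx2]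
      exact this
  have hcleq : T.closure = T.adjoint := eq_of_eq_graph hgraph
  have hda : Dense (T.adjoint.domain : Set H) := hd.mono hle.1
  refine ⟨hd, hT, ?_⟩
  rw [hcleq, isSelfAdjoint_def]
  -- `T ≤ T*` gives `T** ≤ T*`; symmetry of `T*` gives `T* ≤ T**`.
  apply le_antisymm
  · refine IsFormalAdjoint.le_adjoint hd fun t y => ?_
    have h1 := (adjoint_isFormalAdjoint hda).symm ⟨t, hle.1 t.2⟩ y
    rw [← h1, hle.2 (x := t) (y := ⟨t, hle.1 t.2⟩) rfl]
  · exact ha.le_adjoint hda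

end LinearPMap

/-! ### Calculus of Lebesgue primitives on the half line -/

/-- `u` is a primitive of `p` on `(0, ∞)`, in the sense of Lebesgue. -/
structure IsPrimitive (u p : ℝ → ℂ) : Prop where
  intervalIntegrable : ∀ {x y : ℝ}, 0 < x → 0 < y → IntervalIntegrable p volume x y
  integral_eq : ∀ {x y : ℝ}, 0 < x → 0 < y → ∫ t in x..y, p t = u y - u x

lemma uIcc_subset_Ioi {x y : ℝ} (hx : 0 < x) (hy : 0 < y) : uIcc x y ⊆ Ioi 0 :=
  fun _ ht => (lt_min hx hy).trans_le ht.1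

lemma AbsolutelyContinuousOnInterval.congr_of_eqOn {f g : ℝ → ℂ} {x y : ℝ}
    (hf : AbsolutelyContinuousOnInterval f x y) (hfg : EqOn f g (uIcc x y)) :
    AbsolutelyContinuousOnInterval g x y := by
  rw [absolutelyContinuousOnInterval_iff] at hf ⊢
  intro ε hε
  obtain ⟨δ, hδ, H⟩ := hf ε hε
  refine ⟨δ, hδ, fun E hE hsum => ?_⟩
  refine (Finset.sum_congr rfl fun i hi => ?_).trans_lt (H E hE hsum)
  obtain ⟨h1, h2⟩ := hE.1 i hi
  rw [hfg h1, hfg h2]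

/-- The real and imaginary parts are absolutely continuous as integrals of real functions;
multiplying by the constants `1` and `I` and adding reassembles the complex integral. -/
lemma absolutelyContinuousOnInterval_intervalIntegral_complex {p : ℝ → ℂ} {x y : ℝ}
    (h : IntervalIntegrable p volume x y) :
    AbsolutelyContinuousOnInterval (fun s => ∫ t in x..s, p t) x y := by
  have hconst : ∀ z : ℂ, AbsolutelyContinuousOnInterval (fun _ : ℝ => z) x y := fun z =>
    ((LipschitzWith.const z).lipschitzOnWith (s := uIcc x y)).absolutelyContinuousOnInterval
  have h1 : IntervalIntegrable (fun t => (p t).re) volume x y := 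
    ⟨h.1.re, h.2.re⟩
  have h2 : IntervalIntegrable (fun t => (p t).im) volume x y := 
    ⟨h.1.im, h.2.im⟩
  have k1 := (h1.absolutelyContinuousOnInterval_intervalIntegral (c := x) (by simp)).fun_smul
    (hconst 1)
  have k2 := (h2.absolutelyContinuousOnInterval_intervalIntegral (c := x) (by simp)).fun_smul
    (hconst Complex.I)
  refine (k1.fun_add k2).congr_of_eqOn fun s hs => ?_
  have hsub : uIcc x s ⊆ uIcc x y := uIcc_subset_uIcc_left hs
  have hp : IntervalIntegrable p volume x s := h.mono_set hsub
  have e1 := Complex.reCLM.intervalIntegral_comp_comm hp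
  have e2 := Complex.imCLM.intervalIntegral_comp_comm hp
  simp only [Complex.reCLM_apply, Complex.imCLM_apply] at e1 e2
  simp only [Complex.real_smul, mul_one, e1, e2, Complex.re_add_im]

namespace IsPrimitive

variable {u p w q : ℝ → ℂ}

lemma eq_add (h : IsPrimitive u p) {x y : ℝ} (hx : 0 < x) (hy : 0 < y) :
    u y = u x + ∫ t in x..y, p t := by
  rw [h.integral_eq hx hy]; ring

lemma of_hasDerivAt (h : ∀ x, 0 < x → HasDerivAt u (p x) x) (hp : ContinuousOn p (Ioi 0)) :
    IsPrimitive u p where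
  intervalIntegrable hx hy := (hp.mono (uIcc_subset_Ioi hx hy)).intervalIntegrable
  integral_eq hx hy := intervalIntegral.integral_eq_sub_of_hasDerivAt
    (fun t ht => h t (uIcc_subset_Ioi hx hy ht))
    (hp.mono (uIcc_subset_Ioi hx hy)).intervalIntegrable

lemma of_intervalIntegrable (hp : ∀ {x y : ℝ}, 0 < x → 0 < y → IntervalIntegrable p volume x y) :
    IsPrimitive (fun x => ∫ t in (1 : ℝ)..x, p t) p where
  intervalIntegrable := hp
  integral_eq hx hy := by
    rw [intervalIntegral.integral_interval_sub_left (hp one_pos hy) (hp one_pos hx)]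

lemma add_const (h : IsPrimitive u p) (z : ℂ) : IsPrimitive (fun x => u x + z) p where
  intervalIntegrable := h.intervalIntegrable
  integral_eq hx hy := by rw [h.integral_eq hx hy]; ring

lemma congr_right (h : IsPrimitive u p) (hpq : ∀ᵐ x, 0 < x → p x = q x) : IsPrimitive u q where
  intervalIntegrable hx hy := (h.intervalIntegrable hx hy).congr_ae <| by
    rw [EventuallyEq, ae_restrict_iff' measurableSet_uIoc]
    filter_upwards [hpq] with t ht hm
    exact ht (uIcc_subset_Ioi hx hy (uIoc_subset_uIcc hm))
  integral_eq hx hy := by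
    rw [← h.integral_eq hx hy]
    refine intervalIntegral.integral_congr_ae ?_
    filter_upwards [hpq] with t ht hm
    exact (ht (uIcc_subset_Ioi hx hy (uIoc_subset_uIcc hm))).symm

lemma conj (h : IsPrimitive u p) :
    IsPrimitive (fun x => starRingEnd ℂ (u x)) (fun x => starRingEnd ℂ (p x)) where
  intervalIntegrable hx hy := by
    have := h.intervalIntegrable hx hy
    exact ⟨Complex.conjLIE.toContinuousLinearEquiv.toContinuousLinearMap.integrable_comp this.1,
      Complex.conjLIE.toContinuousLinearEquiv.toContinuousLinearMap.integrable_comp this.2⟩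
  integral_eq hx hy := by
    rw [← map_sub, ← h.integral_eq hx hy]
    simp only [intervalIntegral, integral_conj, map_sub]

lemma sub (h : IsPrimitive u p) (h' : IsPrimitive w q) :
    IsPrimitive (fun x => u x - w x) (fun x => p x - q x) where
  intervalIntegrable hx hy := (h.intervalIntegrable hx hy).sub (h'.intervalIntegrable hx hy)
  integral_eq hx hy := by
    rw [intervalIntegral.integral_sub (h.intervalIntegrable hx hy)
      (h'.intervalIntegrable hx hy), h.integral_eq hx hy, h'.integral_eq hx hy]
    ring

lemma absolutelyContinuousOnInterval (h : IsPrimitive u p) {x y : ℝ} (hx : 0 < x) (hy : 0 < y) :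
    AbsolutelyContinuousOnInterval u x y := by
  have hconst : AbsolutelyContinuousOnInterval (fun _ : ℝ => u x) x y :=
    ((LipschitzWith.const (u x)).lipschitzOnWith (s := uIcc x y)).absolutelyContinuousOnInterval
  refine (hconst.fun_add (absolutelyContinuousOnInterval_intervalIntegral_complex
    (h.intervalIntegrable hx hy))).congr_of_eqOn fun s hs => ?_
  exact (h.eq_add hx (uIcc_subset_Ioi hx hy hs)).symm

lemma continuousOn (h : IsPrimitive u p) : ContinuousOn u (Ioi 0) := by
  intro x hx
  have hx : 0 < x := hx
  have := (h.absolutelyContinuousOnInterval (x := x / 2) (y := x + 1) (by positivity)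
    (by positivity)).continuousOn
  refine (this.continuousAt ?_).continuousWithinAt
  rw [uIcc_of_le (by linarith)]
  exact Icc_mem_nhds (by linarith) (by linarith)

lemma ae_hasDerivAt (h : IsPrimitive u p) {x y : ℝ} (hx : 0 < x) (hy : 0 < y) :
    ∀ᵐ t, t ∈ uIcc x y → HasDerivAt u (p t) t := by
  filter_upwards [(h.intervalIntegrable hx hy).ae_hasDerivAt_integral] with t ht hm
  have h1 := (ht hm x left_mem_uIcc).const_add (u x)
  refine h1.congr_of_eventuallyEq ?_
  filter_upwards [Ioi_mem_nhds (uIcc_subset_Ioi hx hy hm)] with s hs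
  exact h.eq_add hx hs

/-- The product rule. -/
lemma mul (h : IsPrimitive u p) (h' : IsPrimitive w q) :
    IsPrimitive (fun x => u x * w x) (fun x => p x * w x + u x * q x) := by
  have hint : ∀ {x y : ℝ}, 0 < x → 0 < y →
      IntervalIntegrable (fun x => p x * w x + u x * q x) volume x y := fun hx hy =>
    ((h.intervalIntegrable hx hy).mul_continuousOn
      (h'.continuousOn.mono (uIcc_subset_Ioi hx hy))).add
      ((h'.intervalIntegrable hx hy).continuousOn_mul
      (h.continuousOn.mono (uIcc_subset_Ioi hx hy)))
  refine ⟨hint, fun {x y} hx hy => ?_⟩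
  -- The product minus the integral of its formal derivative is absolutely continuous with
  -- derivative zero almost everywhere, hence constant.
  have hac := ((h.absolutelyContinuousOnInterval hx hy).fun_smul
    (h'.absolutelyContinuousOnInterval hx hy)).fun_sub
    (absolutelyContinuousOnInterval_intervalIntegral_complex (hint hx hy))
  obtain ⟨z, hz⟩ := hac.const_of_ae_hasDerivAt_zero <| by
    filter_upwards [h.ae_hasDerivAt hx hy, h'.ae_hasDerivAt hx hy,
      (hint hx hy).ae_hasDerivAt_integral] with t h1 h2 h3 hm
    have := ((h1 hm).mul (h2 hm)).sub (h3 hm x left_mem_uIcc)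
    rwa [sub_self] at this
  have e1 := hz x left_mem_uIcc
  have e2 := hz y right_mem_uIcc
  simp only [intervalIntegral.integral_same, smul_eq_mul] at e1 e2
  rw [← e1] at e2
  linear_combination -e2

end IsPrimitive

/-! ### Test functions and weak derivatives -/

/-- Smooth real functions with compact support in `(0, ∞)`. -/
structure IsHalfLineTest (χ : ℝ → ℝ) : Prop where
  contDiff : ContDiff ℝ ∞ χ
  hasCompactSupport : HasCompactSupport χ
  tsupport_subset : tsupport χ ⊆ Ioi 0

lemma IsCompact.exists_subset_Ioo_of_subset_Ioi {K : Set ℝ} (hK : IsCompact K) (h : K ⊆ Ioi 0) :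
    ∃ α β : ℝ, 0 < α ∧ α < β ∧ K ⊆ Ioo α β := by
  rcases K.eq_empty_or_nonempty with rfl | hne
  · exact ⟨1, 2, one_pos, one_lt_two, empty_subset _⟩
  obtain ⟨m, hm, hmin⟩ := hK.exists_isLeast hne
  obtain ⟨M, hM, hmax⟩ := hK.exists_isGreatest hne
  have h0 : 0 < m := h hm
  have h1 : m ≤ M := hmin hM
  exact ⟨m / 2, M + 1, by linarith, by linarith, fun x hx =>
    ⟨by linarith [hmin hx], by linarith [hmax hx]⟩⟩

lemma setIntegral_Ioi_eq_intervalIntegral {E : Type*} [NormedAddCommGroup E] [NormedSpace ℝ E]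
    {F : ℝ → E} {α β : ℝ} (hα : 0 < α) (hF : ∀ x, x ∉ Ioo α β → F x = 0) :
    ∫ x in Ioi (0 : ℝ), F x = ∫ x in α..β, F x := by
  rw [setIntegral_eq_integral_of_forall_compl_eq_zero (s := Ioi 0) fun x hx => hF x fun h =>
    hx (hα.trans h.1)]
  refine (intervalIntegral.integral_eq_integral_of_support_subset fun x hx => ?_).symm
  by_contra h
  exact hx (hF x fun h' => h (Ioo_subset_Ioc_self h'))

namespace IsHalfLineTest

variable {χ ψ : ℝ → ℝ}

lemma hasDerivAt (h : IsHalfLineTest χ) (x : ℝ) : HasDerivAt χ (deriv χ x) x :=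
  (h.contDiff.differentiable (by simp) x).hasDerivAt

lemma continuous_deriv (h : IsHalfLineTest χ) : Continuous (deriv χ) :=
  h.contDiff.continuous_deriv (by simp)

lemma exists_Ioo (h : IsHalfLineTest χ) :
    ∃ α β : ℝ, 0 < α ∧ α < β ∧ tsupport χ ⊆ Ioo α β :=
  IsCompact.exists_subset_Ioo_of_subset_Ioi h.hasCompactSupport h.tsupport_subset

lemma eq_zero {α β : ℝ} (hs : tsupport χ ⊆ Ioo α β) {x : ℝ} (hx : x ∉ Ioo α β) : χ x = 0 :=
  image_eq_zero_of_notMem_tsupport fun h => hx (hs h)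

lemma deriv_eq_zero {α β : ℝ} (hs : tsupport χ ⊆ Ioo α β) {x : ℝ} (hx : x ∉ Ioo α β) :
    deriv χ x = 0 := by
  by_contra h
  exact hx (hs (support_deriv_subset h))

lemma integrableOn_smul {g : ℝ → ℂ} (h : IsHalfLineTest χ) (hg : LocallyIntegrableOn g (Ioi 0)) :
    IntegrableOn (fun x => χ x • g x) (Ioi 0) := by
  obtain ⟨α, β, hα, hαβ, hs⟩ := h.exists_Ioo
  have h1 : IntegrableOn (fun x => χ x • g x) (Icc α β) :=
    (hg.integrableOn_compact_subset (fun x hx => hα.trans_le hx.1) isCompact_Icc).continuousOn_smul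
      h.contDiff.continuous.continuousOn isCompact_Icc
  refine h1.of_forall_sdiff_eq_zero measurableSet_Ioi fun x hx => ?_
  rw [eq_zero hs fun h' => hx.2 (Ioo_subset_Icc_self h'), zero_smul]

lemma smul (c : ℝ) (h : IsHalfLineTest χ) : IsHalfLineTest (fun x => c * χ x) where
  contDiff := contDiff_const.mul h.contDiff
  hasCompactSupport := h.hasCompactSupport.mul_left
  tsupport_subset := (tsupport_mul_subset_right (f := fun _ => c)).trans h.tsupport_subset

lemma sub (h : IsHalfLineTest χ) (h' : IsHalfLineTest ψ) :
    IsHalfLineTest (fun x => χ x - ψ x) where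
  contDiff := h.contDiff.sub h'.contDiff
  hasCompactSupport := h.hasCompactSupport.sub h'.hasCompactSupport
  tsupport_subset := (tsupport_sub χ ψ).trans (union_subset h.tsupport_subset h'.tsupport_subset)

/-- A test function is the derivative of a test function if its integral vanishes. -/
lemma exists_deriv_eq (h : IsHalfLineTest χ) (h0 : ∫ x in Ioi (0 : ℝ), χ x = 0) :
    ∃ Φ, IsHalfLineTest Φ ∧ deriv Φ = χ := by
  obtain ⟨α, β, hα, hαβ, hs⟩ := h.exists_Ioo
  have hc := h.contDiff.continuous
  have hd : ∀ x, HasDerivAt (fun x => ∫ t in α..x, χ t) (χ x) x := fun x =>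
    hc.integral_hasStrictDerivAt α x |>.hasDerivAt
  have hderiv : deriv (fun x => ∫ t in α..x, χ t) = χ := funext fun x => (hd x).deriv
  -- To the left of `α` the integrand vanishes; to the right of `β` the whole integral has been
  -- collected, and it is zero by `h0`.
  have hz : ∀ x, x ∉ Icc α β → ∫ t in α..x, χ t = 0 := by
    intro x hx
    rw [setIntegral_Ioi_eq_intervalIntegral hα fun x => eq_zero hs] at h0
    have hzero : ∀ y, (∀ t ∈ uIcc y x, t ∉ Ioo α β) → ∫ t in y..x, χ t = 0 := fun y hy => by
      rw [intervalIntegral.integral_congr (g := fun _ => 0) fun t ht => eq_zero hs (hy t ht)]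
      simp
    rcases lt_or_ge x α with hxα | hxα
    · refine hzero α fun t ht h' => ?_
      rw [uIcc_of_ge hxα.le] at ht
      linarith [ht.2, h'.1]
    · have hβx : β < x := not_le.1 fun h' => hx ⟨hxα, h'⟩
      rw [← intervalIntegral.integral_add_adjacent_intervals (hc.intervalIntegrable α β)
        (hc.intervalIntegrable β x), h0, zero_add]
      refine hzero β fun t ht h' => ?_
      rw [uIcc_of_le hβx.le] at ht
      linarith [ht.1, h'.2]
  have hts : tsupport (fun x => ∫ t in α..x, χ t) ⊆ Icc α β :=
    closure_minimal (fun x hx => by_contra fun h' => hx (hz x h')) isClosed_Icc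
  refine ⟨_, ⟨?_, HasCompactSupport.intro isCompact_Icc hz, fun x hx => hα.trans_le (hts hx).1⟩,
    hderiv⟩
  rw [contDiff_infty_iff_deriv, hderiv]
  exact ⟨fun x => (hd x).differentiableAt, h.contDiff⟩

/-- Integration by parts against a test function. -/
lemma integral_deriv_smul {u p : ℝ → ℂ} (h : IsHalfLineTest χ) (hu : IsPrimitive u p) :
    ∫ x in Ioi (0 : ℝ), deriv χ x • u x = -∫ x in Ioi (0 : ℝ), χ x • p x := by
  obtain ⟨α, β, hα, hαβ, hs⟩ := h.exists_Ioo
  have hβ := hα.trans hαβ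
  have hχ : IsPrimitive (fun x => (χ x : ℂ)) (fun x => ((deriv χ x : ℝ) : ℂ)) :=
    .of_hasDerivAt (fun x _ => (h.hasDerivAt x).ofReal_comp)
      (Complex.continuous_ofReal.comp h.continuous_deriv).continuousOn
  have key := (hχ.mul hu).integral_eq hα hβ
  rw [eq_zero hs (by simp), eq_zero hs (by simp), intervalIntegral.integral_add
    ((hχ.intervalIntegrable hα hβ).mul_continuousOn
      (hu.continuousOn.mono (uIcc_subset_Ioi hα hβ)))
    ((hu.intervalIntegrable hα hβ).continuousOn_mul
      (hχ.continuousOn.mono (uIcc_subset_Ioi hα hβ)))] at key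
  rw [setIntegral_Ioi_eq_intervalIntegral hα (β := β) fun x hx => by
      rw [deriv_eq_zero hs hx, zero_smul],
    setIntegral_Ioi_eq_intervalIntegral hα (β := β) fun x hx => by rw [eq_zero hs hx, zero_smul]]
  rw [Complex.ofReal_zero, zero_mul, zero_mul, sub_zero] at key
  simp only [Complex.real_smul]
  linear_combination key

lemma exists_integral_eq_one : ∃ ψ, IsHalfLineTest ψ ∧ ∫ x in Ioi (0 : ℝ), ψ x = 1 := by
  let f : ContDiffBump (2 : ℝ) := ⟨1 / 2, 1, by norm_num, by norm_num⟩
  have hts : tsupport (f.normed volume) ⊆ Ioi 0 := by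
    rw [f.tsupport_normed_eq, Real.closedBall_eq_Icc]
    intro x hx
    have : (2 : ℝ) - 1 ≤ x := hx.1
    exact mem_Ioi.2 (by linarith)
  refine ⟨f.normed volume, ⟨f.contDiff_normed, f.hasCompactSupport_normed, hts⟩, ?_⟩
  rw [setIntegral_eq_integral_of_forall_compl_eq_zero fun x hx =>
    image_eq_zero_of_notMem_tsupport fun h => hx (hts h)]
  exact f.integral_normed

end IsHalfLineTest

/-- du Bois-Reymond: a function with a locally integrable weak derivative is almost everywhere
equal to a primitive of that derivative. -/
theorem exists_isPrimitive_of_weak_deriv {g p : ℝ → ℂ} (hg : LocallyIntegrableOn g (Ioi 0))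
    (hp : LocallyIntegrableOn p (Ioi 0))
    (h : ∀ χ, IsHalfLineTest χ →
      ∫ x in Ioi (0 : ℝ), deriv χ x • g x = -∫ x in Ioi (0 : ℝ), χ x • p x) :
    ∃ u, IsPrimitive u p ∧ ∀ᵐ x, 0 < x → g x = u x := by
  have hpi : ∀ {x y : ℝ}, 0 < x → 0 < y → IntervalIntegrable p volume x y := fun hx hy =>
    (hp.integrableOn_compact_subset (uIcc_subset_Ioi hx hy) isCompact_uIcc).intervalIntegrable
  have hQ := IsPrimitive.of_intervalIntegrable hpi
  set Q : ℝ → ℂ := fun x => ∫ t in (1 : ℝ)..x, p t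
  have hQl : LocallyIntegrableOn Q (Ioi 0) :=
    hQ.continuousOn.locallyIntegrableOn measurableSet_Ioi
  have hl : LocallyIntegrableOn (fun x => g x - Q x) (Ioi 0) := hg.sub hQl
  have hderiv : ∀ χ, IsHalfLineTest χ → IsHalfLineTest (deriv χ) →
      ∫ x in Ioi (0 : ℝ), deriv χ x • (g x - Q x) = 0 := by
    intro χ hχ hχ'
    simp only [smul_sub]
    rw [integral_sub (hχ'.integrableOn_smul hg) (hχ'.integrableOn_smul hQl), h χ hχ,
      hχ.integral_deriv_smul hQ, sub_self]
  obtain ⟨ψ, hψ, hψ1⟩ := IsHalfLineTest.exists_integral_eq_one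
  -- `g - Q` has zero weak derivative; its constant value is read off by pairing with `ψ`, which has
  -- mass one.
  set c : ℂ := ∫ x in Ioi (0 : ℝ), ψ x • (g x - Q x) with hc
  refine ⟨fun x => Q x + c, hQ.add_const c, ?_⟩
  have hint : ∀ χ, IsHalfLineTest χ → IntegrableOn χ (Ioi 0) := fun χ hχ =>
    (hχ.contDiff.continuous.integrable_of_hasCompactSupport hχ.hasCompactSupport).integrableOn
  have key := isOpen_Ioi.ae_eq_zero_of_integral_contDiff_smul_eq_zero (μ := volume) (U := Ioi (0 : ℝ))
    (f := fun x => g x - Q x - c) (hl.sub (locallyIntegrableOn_const c)) ?_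
  · filter_upwards [key] with x hx h0
    linear_combination hx h0
  intro χ hχ1 hχ2 hχ3
  have hχ : IsHalfLineTest χ := ⟨hχ1, hχ2, hχ3⟩
  set m : ℝ := ∫ x in Ioi (0 : ℝ), χ x with hm
  -- Removing the mass `m` makes the test function a derivative, and derivatives pair to zero with
  -- `g - Q`.
  have hη := hχ.sub (hψ.smul m)
  obtain ⟨Φ, hΦ, hΦ'⟩ := hη.exists_deriv_eq <| by
    rw [integral_sub (hint χ hχ) ((hint ψ hψ).const_mul m), integral_const_mul, hψ1, mul_one,
      sub_self]
  have hz := hderiv Φ hΦ (hΦ' ▸ hη)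
  rw [hΦ'] at hz
  have e1 := hχ.integrableOn_smul hl
  have e2 := hψ.integrableOn_smul hl
  rw [← setIntegral_eq_integral_of_forall_compl_eq_zero (s := Ioi 0) fun x hx => by
    rw [image_eq_zero_of_notMem_tsupport fun h => hx (hχ3 h), zero_smul]]
  have s1 : ∫ x in Ioi (0 : ℝ), (χ x - m * ψ x) • (g x - Q x)
      = (∫ x in Ioi (0 : ℝ), χ x • (g x - Q x)) - m • c := by
    rw [hc, ← integral_smul, ← integral_sub e1 (Integrable.fun_smul m e2)]
    refine integral_congr_ae (ae_of_all _ fun x => ?_)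
    simp only [sub_smul, mul_smul]
  have s2 : ∫ x in Ioi (0 : ℝ), χ x • (g x - Q x - c)
      = (∫ x in Ioi (0 : ℝ), χ x • (g x - Q x)) - m • c := by
    rw [hm, ← integral_smul_const, ← integral_sub e1 ((hint χ hχ).smul_const c)]
    refine integral_congr_ae (ae_of_all _ fun x => ?_)
    simp only [smul_sub]
  rw [s2, ← s1, hz]

/-! ### Linear first-order equations near the singular endpoint -/

lemma tendsto_intervalIntegral_zero {E : Type*} [NormedAddCommGroup E] [NormedSpace ℝ E]
    {p : ℝ → E} {δ : ℝ} (hδ : 0 < δ) (hp : IntegrableOn p (Ioc 0 δ)) :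
    Tendsto (fun x => ∫ t in (0 : ℝ)..x, p t) (𝓝[>] 0) (𝓝 0) := by
  have h1 : IntegrableOn p (uIcc 0 δ) := by
    rwa [uIcc_of_le hδ.le, integrableOn_Icc_iff_integrableOn_Ioc]
  have h2 := intervalIntegral.continuousOn_primitive_interval h1 0 left_mem_uIcc
  rw [ContinuousWithinAt, intervalIntegral.integral_same, uIcc_of_le hδ.le] at h2
  exact h2.mono_left (nhdsWithin_le_of_mem (mem_of_superset (Ioo_mem_nhdsGT hδ)
    Ioo_subset_Icc_self))

namespace IsPrimitive

variable {u p q : ℝ → ℂ} {v V : ℝ → ℝ} {δ : ℝ}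

lemma exists_eq_add_integral (h : IsPrimitive u p) (hδ : 0 < δ) (hp : IntegrableOn p (Ioc 0 δ)) :
    ∃ L, ∀ x ∈ Ioc 0 δ, u x = L + ∫ t in (0 : ℝ)..x, p t := by
  refine ⟨u δ - ∫ t in (0 : ℝ)..δ, p t, fun x hx => ?_⟩
  have h1 : IntervalIntegrable p volume 0 x :=
    (intervalIntegrable_iff_integrableOn_Ioc_of_le hx.1.le).2
      (hp.mono_set (Ioc_subset_Ioc_right hx.2))
  rw [← intervalIntegral.integral_add_adjacent_intervals h1 (h.intervalIntegrable hx.1 hδ),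
    h.integral_eq hx.1 hδ]
  ring

/-- An integrable derivative forces a limit at infinity, and integrability of `u` itself excludes
any limit but zero. -/
lemma tendsto_atTop_zero (h : IsPrimitive u p) (hp : IntegrableOn p (Ioi 1))
    (hu : IntegrableOn u (Ioi 1)) : Tendsto u atTop (𝓝 0) := by
  have h1 : Tendsto u atTop (𝓝 (u 1 + ∫ t in Ioi (1 : ℝ), p t)) := by
    refine Tendsto.congr' ?_ ((intervalIntegral_tendsto_integral_Ioi 1 hp tendsto_id).const_add _)
    filter_upwards [eventually_gt_atTop 0] with x hx
    exact (h.eq_add one_pos hx).symm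
  have h2 : IntegrableAtFilter u atTop volume := ⟨Ioi 1, Ioi_mem_atTop 1, hu⟩
  have h3 := h2.eq_zero_of_tendsto (fun s hs => by
    obtain ⟨c, hc⟩ := mem_atTop_sets.1 hs
    exact measure_mono_top hc Real.volume_Ici) h1
  rwa [h3] at h1

/-- The integrating factor: with `V` or `-V` it absorbs the terms `-(v u)` or `v u` of the equations
below. -/
lemma exp_mul (hV : ∀ x, 0 < x → HasDerivAt V (v x) x) (hv : ContinuousOn v (Ioi 0))
    (h : IsPrimitive u p) :
    IsPrimitive (fun x => (Real.exp (V x) : ℂ) * u x)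
      (fun x => (Real.exp (V x) : ℂ) * (v x * u x + p x)) := by
  have hVc : ContinuousOn V (Ioi 0) := fun x hx => (hV x hx).continuousAt.continuousWithinAt
  have hE : IsPrimitive (fun x => (Real.exp (V x) : ℂ))
      (fun x => ((Real.exp (V x) * v x : ℝ) : ℂ)) :=
    .of_hasDerivAt (fun x hx => ((hV x hx).exp).ofReal_comp)
      (Complex.continuous_ofReal.comp_continuousOn ((Real.continuous_exp.comp_continuousOn hVc).mul hv))
  refine (hE.mul h).congr_right (ae_of_all _ fun x _ => ?_)
  push_cast
  ring

lemma antitoneOn_of_nonpos (hV : ∀ x, 0 < x → HasDerivAt V (v x) x)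
    (hneg : ∀ x ∈ Ioc 0 δ, v x ≤ 0) : AntitoneOn V (Ioc 0 δ) := by
  refine antitoneOn_of_deriv_nonpos (convex_Ioc 0 δ)
    (fun x hx => (hV x hx.1).continuousAt.continuousWithinAt)
    (fun x hx => (hV x (interior_subset hx).1).differentiableAt.differentiableWithinAt)
    fun x hx => ?_
  have hx := interior_subset hx
  rw [(hV x hx.1).deriv]
  exact hneg x hx

/-- Solutions of `u' = -v u + q` are bounded near `0` if `v ≤ 0` and `q` is integrable. -/
lemma exists_bound_of_nonpos (hδ : 0 < δ) (hV : ∀ x, 0 < x → HasDerivAt V (v x) x)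
    (hv : ContinuousOn v (Ioi 0)) (hneg : ∀ x ∈ Ioc 0 δ, v x ≤ 0)
    (hq : IntegrableOn q (Ioc 0 δ)) (h : IsPrimitive u (fun x => -(v x * u x) + q x)) :
    ∃ K, ∀ x ∈ Ioc 0 δ, ‖u x‖ ≤ K := by
  have hanti := antitoneOn_of_nonpos hV hneg
  have hw : IsPrimitive (fun x => (Real.exp (V x) : ℂ) * u x)
      (fun x => (Real.exp (V x) : ℂ) * q x) :=
    (exp_mul hV hv h).congr_right (ae_of_all _ fun x _ => by ring)
  refine ⟨‖u δ‖ + ∫ t in Ioc 0 δ, ‖q t‖, fun x hx => ?_⟩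
  -- `V` is decreasing, so every weight on `[x, δ]` is at most `exp (V x)`, the factor in front of
  -- `u x`; that factor then cancels.
  have hle : ∀ t ∈ Icc x δ, Real.exp (V t) ≤ Real.exp (V x) := fun t ht =>
    Real.exp_le_exp.2 (hanti hx ⟨hx.1.trans_le ht.1, ht.2⟩ ht.1)
  have e := hw.integral_eq hx.1 hδ
  have hqi : IntegrableOn q (Ioc x δ) := hq.mono_set (Ioc_subset_Ioc_left hx.1.le)
  have hb : ‖∫ t in x..δ, (Real.exp (V t) : ℂ) * q t‖
      ≤ Real.exp (V x) * ∫ t in Ioc 0 δ, ‖q t‖ := by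
    calc _ ≤ ∫ t in x..δ, Real.exp (V x) * ‖q t‖ := by
          refine intervalIntegral.norm_integral_le_of_norm_le hx.2 (ae_of_all _ fun t ht => ?_)
            ((intervalIntegrable_iff_integrableOn_Ioc_of_le hx.2).2 (hqi.norm.const_mul _))
          rw [norm_mul, Complex.norm_real, Real.norm_of_nonneg (Real.exp_pos _).le]
          exact mul_le_mul_of_nonneg_right (hle t (Ioc_subset_Icc_self ht)) (norm_nonneg _)
      _ = Real.exp (V x) * ∫ t in Ioc x δ, ‖q t‖ := by
          rw [intervalIntegral.integral_const_mul, intervalIntegral.integral_of_le hx.2]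
      _ ≤ _ := by
          gcongr
          · exact ae_of_all _ fun t => norm_nonneg _
          · exact hq.norm
          · exact hx.1.le
  have hpos := Real.exp_pos (V x)
  have hn : ∀ t, ‖(Real.exp (V t) : ℂ) * u t‖ = Real.exp (V t) * ‖u t‖ := fun t => by
    rw [norm_mul, Complex.norm_real, Real.norm_of_nonneg (Real.exp_pos _).le]
  have : Real.exp (V x) * ‖u x‖ ≤ Real.exp (V x) * (‖u δ‖ + ∫ t in Ioc 0 δ, ‖q t‖) := by
    rw [← hn x, show (Real.exp (V x) : ℂ) * u x = (Real.exp (V δ) : ℂ) * u δ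
      - ∫ t in x..δ, (Real.exp (V t) : ℂ) * q t by rw [e]; ring]
    refine (norm_sub_le _ _).trans ?_
    rw [hn δ, mul_add]
    exact add_le_add (mul_le_mul_of_nonneg_right (hle δ ⟨hx.2, le_rfl⟩) (norm_nonneg _)) hb
  exact le_of_mul_le_mul_left this hpos

/-- Square integrable solutions of `u' = v u + q` tend to `0` at `0` if `v ≤ 0`, `q` is integrable
and `exp ∫ v` is not square integrable at `0`. -/
lemma tendsto_zero_of_nonpos (hδ : 0 < δ) (hV : ∀ x, 0 < x → HasDerivAt V (v x) x)
    (hv : ContinuousOn v (Ioi 0)) (hneg : ∀ x ∈ Ioc 0 δ, v x ≤ 0)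
    (hV2 : ∀ ε > 0, ¬ IntegrableOn (fun x => Real.exp (2 * V x)) (Ioc 0 ε))
    (hq : IntegrableOn q (Ioc 0 δ)) (hu : IntegrableOn (fun x => ‖u x‖ ^ 2) (Ioc 0 δ))
    (h : IsPrimitive u (fun x => v x * u x + q x)) :
    Tendsto u (𝓝[>] 0) (𝓝 0) := by
  have hanti := antitoneOn_of_nonpos hV hneg
  have hVc : ContinuousOn V (Ioi 0) := fun x hx => (hV x hx).continuousAt.continuousWithinAt
  have hw : IsPrimitive (fun x => (Real.exp (-V x) : ℂ) * u x)
      (fun x => (Real.exp (-V x) : ℂ) * q x) :=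
    (exp_mul (V := fun x => -V x) (fun x hx => (hV x hx).neg) hv.neg h).congr_right
      (ae_of_all _ fun x _ => by push_cast; ring)
  have hn : ∀ t (z : ℂ), ‖(Real.exp (-V t) : ℂ) * z‖ = Real.exp (-V t) * ‖z‖ := fun t z => by
    rw [norm_mul, Complex.norm_real, Real.norm_of_nonneg (Real.exp_pos _).le]
  -- Since `V` decreases, `exp (-V)` is bounded by its value at `δ`; hence `exp (-V) u` has a limit
  -- `L` at `0`.
  have hEq : IntegrableOn (fun x => (Real.exp (-V x) : ℂ) * q x) (Ioc 0 δ) := by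
    refine Integrable.bdd_mul (c := Real.exp (-V δ)) hq ?_ ?_
    · refine ContinuousOn.aestronglyMeasurable ?_ measurableSet_Ioc
      exact (Complex.continuous_ofReal.comp_continuousOn
        (Real.continuous_exp.comp_continuousOn hVc.neg)).mono fun x hx => hx.1
    · filter_upwards [ae_restrict_mem measurableSet_Ioc] with t ht
      rw [Complex.norm_real, Real.norm_of_nonneg (Real.exp_pos _).le, Real.exp_le_exp, neg_le_neg_iff]
      exact hanti ht ⟨hδ, le_rfl⟩ ht.2
  obtain ⟨L, hL⟩ := hw.exists_eq_add_integral hδ hEq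
  have hlim : Tendsto (fun x => (Real.exp (-V x) : ℂ) * u x) (𝓝[>] 0) (𝓝 L) := by
    have := (tendsto_intervalIntegral_zero hδ hEq).const_add L
    rw [add_zero] at this
    refine this.congr' ?_
    filter_upwards [Ioc_mem_nhdsGT hδ] with x hx using (hL x hx).symm
  -- If `L ≠ 0`, then `‖u‖ ≥ ‖L‖ / 2 * exp V` near `0`, and square integrability of `u` would pass
  -- to `exp V`.
  have hL0 : L = 0 := by
    by_contra hne
    have hpos : 0 < ‖L‖ := norm_pos_iff.2 hne
    obtain ⟨ε, hε, hsub⟩ := mem_nhdsGT_iff_exists_Ioc_subset.1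
      ((hlim.norm.eventually_const_le (half_lt_self hpos)).and (Ioc_mem_nhdsGT hδ))
    refine hV2 ε hε ?_
    have hb : ∀ x ∈ Ioc 0 ε, Real.exp (2 * V x) ≤ 4 / ‖L‖ ^ 2 * ‖u x‖ ^ 2 := by
      intro x hx
      have h1 : ‖L‖ / 2 ≤ Real.exp (-V x) * ‖u x‖ := (hsub hx).1.trans_eq (hn x _)
      have h2 : Real.exp (V x) * (‖L‖ / 2) ≤ ‖u x‖ := by
        calc _ ≤ Real.exp (V x) * (Real.exp (-V x) * ‖u x‖) := by gcongr
          _ = ‖u x‖ := by rw [← mul_assoc, ← Real.exp_add]; simp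
      have h3 : (Real.exp (V x) * (‖L‖ / 2)) ^ 2 ≤ ‖u x‖ ^ 2 := by gcongr
      rw [two_mul, Real.exp_add, div_mul_eq_mul_div, le_div_iff₀ (by positivity)]
      nlinarith [h3]
    refine Integrable.mono' ((hu.mono_set fun x hx => ⟨hx.1, (hsub hx).2.2⟩).const_mul
      (4 / ‖L‖ ^ 2)) ?_ ?_
    · refine ContinuousOn.aestronglyMeasurable ?_ measurableSet_Ioc
      exact (Real.continuous_exp.comp_continuousOn (continuousOn_const.mul hVc)).mono
        fun x hx => hx.1
    · filter_upwards [ae_restrict_mem measurableSet_Ioc] with x hx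
      rw [Real.norm_of_nonneg (Real.exp_pos _).le]
      exact hb x hx
  -- With `L = 0`, `exp (-V x) u x` is an integral from `0` to `x`. The weight `exp (-V)` is largest
  -- at `x` and cancels, leaving `‖u x‖ ≤ ∫ ‖q‖` over `(0, x)`.
  refine squeeze_zero_norm' ?_ (tendsto_intervalIntegral_zero hδ hq.norm)
  filter_upwards [Ioc_mem_nhdsGT hδ] with x hx
  have e := hL x hx
  rw [hL0, zero_add] at e
  have hqx : IntegrableOn q (Ioc 0 x) := hq.mono_set (Ioc_subset_Ioc_right hx.2)
  have hb : Real.exp (-V x) * ‖u x‖ ≤ Real.exp (-V x) * ∫ t in (0 : ℝ)..x, ‖q t‖ := by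
    rw [← hn x, e, ← intervalIntegral.integral_const_mul]
    refine intervalIntegral.norm_integral_le_of_norm_le hx.1.le (ae_of_all _ fun t ht => ?_)
      ((intervalIntegrable_iff_integrableOn_Ioc_of_le hx.1.le).2 (hqx.norm.const_mul _))
    rw [hn]
    refine mul_le_mul_of_nonneg_right (Real.exp_le_exp.2 (neg_le_neg ?_)) (norm_nonneg _)
    exact hanti ⟨ht.1, ht.2.trans hx.2⟩ hx ht.2
  exact le_of_mul_le_mul_left hb (Real.exp_pos _)

end IsPrimitive

/-- Boundary behaviour at `0` of square integrable functions with square integrable image under a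
Dirac type expression. -/
theorem tendsto_zero_and_exists_bound_of_dirac_system {a b v V : ℝ → ℝ} {u₀ u₁ w₀ w₁ : ℝ → ℂ}
    {δ : ℝ} (hδ : 0 < δ) (hV : ∀ x, 0 < x → HasDerivAt V (v x) x) (hv : ContinuousOn v (Ioi 0))
    (hneg : ∀ x ∈ Ioc 0 δ, v x ≤ 0)
    (hV2 : ∀ ε > 0, ¬ IntegrableOn (fun x => Real.exp (2 * V x)) (Ioc 0 ε))
    (ha : MemLp a 2 (volume.restrict (Ioc 0 δ))) (hb : MemLp b 2 (volume.restrict (Ioc 0 δ)))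
    (hu₀ : MemLp u₀ 2 (volume.restrict (Ioc 0 δ))) (hu₁ : MemLp u₁ 2 (volume.restrict (Ioc 0 δ)))
    (hw₀ : MemLp w₀ 2 (volume.restrict (Ioc 0 δ))) (hw₁ : MemLp w₁ 2 (volume.restrict (Ioc 0 δ)))
    (h₀ : IsPrimitive u₀ (fun x => w₁ x - v x * u₀ x + ((a x : ℂ) + b x) * u₁ x))
    (h₁ : IsPrimitive u₁ (fun x => ((a x : ℂ) - b x) * u₀ x + v x * u₁ x - w₀ x)) :
    Tendsto u₁ (𝓝[>] 0) (𝓝 0) ∧ ∃ K, ∀ x ∈ Ioc 0 δ, ‖u₀ x‖ ≤ K := by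
  -- On a bounded interval `L²` functions are integrable, which covers the terms `w₀` and `w₁`.
  have : IsFiniteMeasure (volume.restrict (Ioc (0 : ℝ) δ)) := ⟨by simp⟩
  have ha' : MemLp (fun x => (a x : ℂ)) 2 (volume.restrict (Ioc 0 δ)) := ha.ofReal
  have hb' : MemLp (fun x => (b x : ℂ)) 2 (volume.restrict (Ioc 0 δ)) := hb.ofReal
  constructor
  · refine IsPrimitive.tendsto_zero_of_nonpos (q := fun x => ((a x : ℂ) - b x) * u₀ x - w₀ x)
      hδ hV hv hneg hV2 (((ha'.sub hb').integrable_mul hu₀).sub (hw₀.integrable one_le_two))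
      (hu₁.integrable_norm_pow two_ne_zero) (h₁.congr_right (ae_of_all _ fun x _ => by ring))
  · refine IsPrimitive.exists_bound_of_nonpos (q := fun x => w₁ x + ((a x : ℂ) + b x) * u₁ x)
      hδ hV hv hneg ((hw₁.integrable one_le_two).add ((ha'.add hb').integrable_mul hu₁))
      (h₀.congr_right (ae_of_all _ fun x _ => by ring))

/-- Assigning the value `l` at `0` makes `g` continuous on `[0, δ]`, where a nonnegative derivative
is integrable. -/
lemma integrableOn_Ioc_deriv_of_nonneg_of_tendsto {g g' : ℝ → ℝ} {δ l : ℝ}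
    (hd : ∀ x ∈ Ioc 0 δ, HasDerivAt g (g' x) x) (hnonneg : ∀ x ∈ Ioc 0 δ, 0 ≤ g' x)
    (hl : Tendsto g (𝓝[>] 0) (𝓝 l)) : IntegrableOn g' (Ioc 0 δ) := by
  have heq : ∀ x, 0 < x → Function.update g 0 l =ᶠ[𝓝 x] g := fun x hx => by
    filter_upwards [Ioi_mem_nhds hx] with y hy using Function.update_of_ne (ne_of_gt hy) _ _
  refine intervalIntegral.integrableOn_deriv_of_nonneg (g := Function.update g 0 l) ?_
    (fun x hx => (hd x (Ioo_subset_Ioc_self hx)).congr_of_eventuallyEq (heq x hx.1))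
    (fun x hx => hnonneg x (Ioo_subset_Ioc_self hx))
  intro x hx
  rcases hx.1.eq_or_lt with rfl | h0
  · rw [continuousWithinAt_update_same]
    exact hl.mono_left (nhdsWithin_mono _ fun y hy => lt_of_le_of_ne hy.1.1 (Ne.symm hy.2))
  · exact ((hd x ⟨h0, hx.2⟩).continuousAt.congr (heq x h0).symm).continuousWithinAt

/-! ### Asymptotics of the coefficients at the central singularity -/

namespace RWN

namespace BlackHole

variable {C : PhysicalConstants} (B : BlackHole C)

lemma hasDerivAt_areaRadius {x : ℝ} (hx : 0 < x) :
    HasDerivAt B.areaRadius (B.fSq (B.areaRadius x)) x := by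
  have hr := B.areaRadius_mem hx
  have h1 := B.hasDerivAt_tortoise (Ioo_subset_Ico_self hr)
  have h2 : B.fSq (B.areaRadius x) = (B.areaRadius x ^ 2 /
      ((B.rPlus - B.areaRadius x) * (B.rMinus - B.areaRadius x)))⁻¹ := by
    rw [inv_div, B.fSq_eq hr.1.ne']
  have hne : B.areaRadius x ^ 2 /
      ((B.rPlus - B.areaRadius x) * (B.rMinus - B.areaRadius x)) ≠ 0 := by
    intro h0
    rw [h0, inv_zero] at h2
    exact (B.fSq_pos hr).ne' h2
  rw [h2]
  refine HasDerivAt.of_local_left_inverse (B.continuousAt_areaRadius hx) h1 hne ?_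
  filter_upwards [Ioi_mem_nhds hx] with y hy using B.tortoise_areaRadius hy

lemma exists_areaRadius_le {ρ : ℝ} (hρ : ρ ∈ Ioo 0 B.rMinus) :
    ∃ δ > 0, ∀ x ∈ Ioc 0 δ, B.areaRadius x ≤ ρ := by
  have hδ : 0 < B.tortoise ρ := by
    have : B.tortoise ρ ∈ Ioi (0 : ℝ) := B.image_tortoise ▸ mem_image_of_mem _ hρ
    exact this
  refine ⟨B.tortoise ρ, hδ, fun x hx => ?_⟩
  rw [← B.areaRadius_tortoise hρ]
  exact B.strictMonoOn_areaRadius.monotoneOn hx.1 hδ hx.2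

lemma tendsto_areaRadius : Tendsto B.areaRadius (𝓝[>] 0) (𝓝[>] 0) := by
  refine tendsto_nhdsWithin_iff.2 ⟨?_, ?_⟩
  · rw [tendsto_order]
    constructor
    · intro c hc
      filter_upwards [self_mem_nhdsWithin] with x hx using hc.trans (B.areaRadius_mem hx).1
    · intro c hc
      obtain ⟨ρ, hρ0, hρ⟩ := exists_between (lt_min hc B.rMinus_pos)
      obtain ⟨δ, hδ, H⟩ := B.exists_areaRadius_le ⟨hρ0, hρ.trans_le (min_le_right _ _)⟩
      filter_upwards [Ioc_mem_nhdsGT hδ] with x hx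
      exact (H x hx).trans_lt (hρ.trans_le (min_le_left _ _))
  · filter_upwards [self_mem_nhdsWithin] with x hx using (B.areaRadius_mem hx).1

lemma a_pos {x : ℝ} (hx : 0 < x) : 0 < B.a x := Real.sqrt_pos.2 (B.fSq_pos (B.areaRadius_mem hx))

lemma a_sq {x : ℝ} (hx : 0 < x) : B.a x ^ 2 = B.fSq (B.areaRadius x) :=
  Real.sq_sqrt (B.fSq_pos (B.areaRadius_mem hx)).le

/-- The product `r f(r)` stays bounded and away from zero as `r → 0`; all later estimates of the
coefficients rest on this. -/
lemma areaRadius_mul_a_sq {x : ℝ} (hx : 0 < x) :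
    (B.areaRadius x * B.a x) ^ 2
      = (B.rPlus - B.areaRadius x) * (B.rMinus - B.areaRadius x) := by
  have hr := (B.areaRadius_mem hx).1.ne'
  rw [mul_pow, B.a_sq hx, B.fSq_eq hr]
  field_simp

/-- The geometric mean of the horizon radii. -/
noncomputable def meanRadius : ℝ :=
  Real.sqrt C.G * C.me * B.Z * C.e / (C.hbar * C.c)

lemma meanRadius_pos : 0 < B.meanRadius := by
  have := C.G_pos
  have := C.hbar_pos
  have := C.c_pos
  have := C.me_pos
  have := C.e_pos
  have hZ : (0 : ℝ) < B.Z := by exact_mod_cast B.Z_pos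
  unfold meanRadius
  positivity

lemma meanRadius_sq : B.meanRadius ^ 2 = B.rPlus * B.rMinus := by
  have h1 := C.G_pos
  have h2 := C.hbar_pos
  have h3 := C.c_pos
  have h4 := B.M_pos
  have hq : 0 ≤ 1 - (B.Z : ℝ) ^ 2 * C.e ^ 2 / (C.G * B.M ^ 2) := by
    rw [sub_nonneg, div_le_one (by positivity)]
    exact B.charge_le
  have hs := Real.sq_sqrt hq
  have hG := Real.sq_sqrt h1.le
  unfold meanRadius rPlus rMinus
  set s := Real.sqrt (1 - (B.Z : ℝ) ^ 2 * C.e ^ 2 / (C.G * B.M ^ 2))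
  have : (C.G * B.M * C.me / (C.hbar * C.c) * (1 + s)) *
      (C.G * B.M * C.me / (C.hbar * C.c) * (1 - s))
      = (C.G * B.M * C.me / (C.hbar * C.c)) ^ 2 * (1 - s ^ 2) := by ring
  rw [this, hs, div_pow, mul_pow, mul_pow, mul_pow, hG]
  field_simp
  ring

/-- The strength of the anomalous magnetic moment term, `Z α² / (4 π)`. -/
noncomputable def momentCoeff : ℝ := B.Z * C.alphaS ^ 2 * (1 / (4 * Real.pi))

lemma momentCoeff_pos : 0 < B.momentCoeff := by
  have := C.hbar_pos
  have := C.c_pos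
  have := C.e_pos
  have := Real.pi_pos
  have hZ : (0 : ℝ) < B.Z := by exact_mod_cast B.Z_pos
  unfold momentCoeff PhysicalConstants.alphaS
  positivity

/-- This identifies the physical threshold with the exponent condition `far * momentCoeff /
meanRadius ≥ 3 / 2`. -/
lemma farCrit_mul_momentCoeff : C.farCrit * B.momentCoeff = 3 / 2 * B.meanRadius := by
  have := C.hbar_pos
  have := C.c_pos
  have := C.me_pos
  have := C.e_pos
  have := Real.pi_pos
  unfold PhysicalConstants.farCrit PhysicalConstants.muClass momentCoeff meanRadius
    PhysicalConstants.alphaS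
  field_simp

lemma le_far_mul_momentCoeff {far : ℝ} (h : C.farCrit ≤ far) :
    3 / 2 * B.meanRadius ≤ far * B.momentCoeff := by
  rw [← farCrit_mul_momentCoeff]
  exact mul_le_mul_of_nonneg_right h B.momentCoeff_pos.le

lemma areaRadius_mul_a_le {x : ℝ} (hx : 0 < x) : B.areaRadius x * B.a x ≤ B.meanRadius := by
  have hr := B.areaRadius_mem hx
  have h1 := hr.1
  have h2 := hr.2
  have h3 := B.rMinus_le_rPlus
  refine le_of_sq_le_sq ?_ B.meanRadius_pos.le
  rw [B.areaRadius_mul_a_sq hx, B.meanRadius_sq]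
  gcongr <;> linarith

lemma le_areaRadius_mul_a {x : ℝ} (hx : 0 < x) (h : B.areaRadius x ≤ B.rMinus / 2) :
    B.rMinus / 2 ≤ B.areaRadius x * B.a x := by
  have h0 := B.rMinus_pos
  have h3 := B.rMinus_le_rPlus
  refine le_of_sq_le_sq ?_ (mul_pos (B.areaRadius_mem hx).1 (B.a_pos hx)).le
  rw [B.areaRadius_mul_a_sq hx, sq]
  gcongr <;> linarith

/-- The off-diagonal coefficient `k c - far d`. -/
noncomputable def offDiag (k : ℤ) (far x : ℝ) : ℝ := k * B.c x - far * B.d x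

lemma continuousOn_offDiag (k : ℤ) (far : ℝ) : ContinuousOn (B.offDiag k far) (Ioi 0) :=
  fun _ hx => ((continuousAt_const.mul (B.continuousAt_c hx)).sub
    (continuousAt_const.mul (B.continuousAt_d hx))).continuousWithinAt

lemma offDiag_eq (k : ℤ) (far : ℝ) {x : ℝ} (hx : 0 < x) :
    B.offDiag k far x = (k * B.areaRadius x - far * B.momentCoeff) * B.a x / B.areaRadius x ^ 2 := by
  have hr := (B.areaRadius_mem hx).1.ne'
  unfold offDiag c d momentCoeff a
  field_simp

/-- A primitive of the off-diagonal coefficient. -/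
noncomputable def offDiagPrimitive (k : ℤ) (far x : ℝ) : ℝ := ∫ t in (1 : ℝ)..x, B.offDiag k far t

lemma hasDerivAt_offDiagPrimitive (k : ℤ) (far : ℝ) {x : ℝ} (hx : 0 < x) :
    HasDerivAt (B.offDiagPrimitive k far) (B.offDiag k far x) x := by
  have hc := B.continuousOn_offDiag k far
  refine intervalIntegral.integral_hasDerivAt_right ?_ ?_ ?_
  · exact (hc.mono (uIcc_subset_Ioi one_pos hx)).intervalIntegrable
  · exact hc.stronglyMeasurableAtFilter isOpen_Ioi x hx
  · exact hc.continuousAt (isOpen_Ioi.mem_nhds hx)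

lemma hasDerivAt_log_areaRadius {x : ℝ} (hx : 0 < x) :
    HasDerivAt (fun x => Real.log (B.areaRadius x)) (B.a x ^ 2 / B.areaRadius x) x := by
  rw [B.a_sq hx]
  exact (B.hasDerivAt_areaRadius hx).log (B.areaRadius_mem hx).1.ne'

lemma exists_offDiag_nonpos (k : ℤ) {far : ℝ} (hfar : C.farCrit ≤ far) :
    ∃ δ > 0, ∀ x ∈ Ioc 0 δ, B.areaRadius x ≤ B.rMinus / 2 ∧ B.offDiag k far x ≤ 0 := by
  have h0 := B.rMinus_pos
  have hp := B.meanRadius_pos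
  have hF := B.le_far_mul_momentCoeff hfar
  -- The second bound gives `|k| r ≤ meanRadius`, which is below `3 / 2 * meanRadius ≤ far *
  -- momentCoeff`.
  set ρ := min (B.rMinus / 2) (B.meanRadius / (|(k : ℝ)| + 1))
  have hρ0 : 0 < ρ := lt_min (by positivity) (by positivity)
  obtain ⟨δ, hδ, H⟩ := B.exists_areaRadius_le (ρ := ρ)
    ⟨hρ0, (min_le_left _ _).trans_lt (by linarith)⟩
  refine ⟨δ, hδ, fun x hx => ⟨(H x hx).trans (min_le_left _ _), ?_⟩⟩
  have hr := (B.areaRadius_mem hx.1).1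
  have h1 : B.areaRadius x ≤ B.meanRadius / (|(k : ℝ)| + 1) := (H x hx).trans (min_le_right _ _)
  rw [le_div_iff₀ (by positivity)] at h1
  have h2 : (k : ℝ) * B.areaRadius x ≤ |(k : ℝ)| * B.areaRadius x :=
    mul_le_mul_of_nonneg_right (le_abs_self _) hr.le
  rw [B.offDiag_eq k far hx.1]
  refine div_nonpos_of_nonpos_of_nonneg (mul_nonpos_of_nonpos_of_nonneg ?_ (B.a_pos hx.1).le)
    (by positivity)
  nlinarith

/-- `a²` is the derivative of `areaRadius`, which has a finite limit at `0`. -/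
lemma memLp_a (δ : ℝ) : MemLp B.a 2 (volume.restrict (Ioc 0 δ)) := by
  have hm : AEStronglyMeasurable B.a (volume.restrict (Ioc 0 δ)) :=
    ContinuousOn.aestronglyMeasurable
      (fun x hx => (B.continuousAt_a hx.1).continuousWithinAt) measurableSet_Ioc
  rw [memLp_two_iff_integrable_sq hm]
  exact integrableOn_Ioc_deriv_of_nonneg_of_tendsto
    (fun x hx => by rw [B.a_sq hx.1]; exact B.hasDerivAt_areaRadius hx.1)
    (fun x _ => sq_nonneg _) (B.tendsto_areaRadius.mono_right nhdsWithin_le_nhds)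

/-- Since `r a ≥ r₋ / 2`, the coefficient `b`, a multiple of `1 / r`, is dominated by a multiple of
`a`. -/
lemma memLp_b {δ : ℝ} (h : ∀ x ∈ Ioc 0 δ, B.areaRadius x ≤ B.rMinus / 2) :
    MemLp B.b 2 (volume.restrict (Ioc 0 δ)) := by
  have h0 := B.rMinus_pos
  have hα : 0 ≤ C.alphaS := by
    have := C.hbar_pos
    have := C.c_pos
    unfold PhysicalConstants.alphaS
    positivity
  refine (B.memLp_a δ).of_le_mul (c := B.Z * C.alphaS / (B.rMinus / 2))
    (ContinuousOn.aestronglyMeasurable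
      (fun x hx => (B.continuousAt_b hx.1).continuousWithinAt) measurableSet_Ioc) ?_
  filter_upwards [ae_restrict_mem measurableSet_Ioc] with x hx
  have hr := (B.areaRadius_mem hx.1).1
  rw [Real.norm_of_nonneg (B.a_pos hx.1).le, b, Real.norm_of_nonneg (by positivity), div_mul_eq_mul_div,
    mul_one_div, div_le_div_iff₀ hr (by positivity), mul_assoc (B.Z * C.alphaS), mul_comm (B.a x)]
  gcongr
  exact B.le_areaRadius_mul_a hx.1 (h x hx)

/-- `exp (2 V)` is at least a multiple of `r⁻³`, hence of `a² / r = (log r)'`, and `log r` is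
unbounded at `0`. At the threshold itself the divergence is just logarithmic. -/
lemma not_integrableOn_exp_offDiagPrimitive (k : ℤ) {far : ℝ} (hfar : C.farCrit ≤ far) {ε : ℝ}
    (hε : 0 < ε) :
    ¬ IntegrableOn (fun x => Real.exp (2 * B.offDiagPrimitive k far x)) (Ioc 0 ε) := by
  have h0 := B.rMinus_pos
  have hp := B.meanRadius_pos
  have hF := B.le_far_mul_momentCoeff hfar
  obtain ⟨δ, hδ, H⟩ := B.exists_areaRadius_le (ρ := B.rMinus / 2) ⟨by linarith, by linarith⟩
  set K : ℝ := 4 * |(k : ℝ)| / B.rMinus with hK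
  have hK0 : 0 ≤ K := by positivity
  -- In `W'`, the threshold condition and `r a ≤ meanRadius` give `3 r a ≤ 2 far * momentCoeff`. The
  -- correction `K r` absorbs the `k` term: `K` is chosen so that `K * (r₋ / 2) = 2 |k|`.
  set W : ℝ → ℝ := fun x => 2 * B.offDiagPrimitive k far x + 3 * Real.log (B.areaRadius x)
    - K * B.areaRadius x with hW
  have hd : ∀ x, 0 < x → HasDerivAt W
      (2 * B.offDiag k far x + 3 * (B.a x ^ 2 / B.areaRadius x) - K * B.a x ^ 2) x := by
    intro x hx
    have := B.hasDerivAt_areaRadius hx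
    rw [← B.a_sq hx] at this
    exact (((B.hasDerivAt_offDiagPrimitive k far hx).const_mul 2).add
      ((B.hasDerivAt_log_areaRadius hx).const_mul 3)).sub (this.const_mul K)
  have hanti : AntitoneOn W (Ioc 0 δ) := by
    refine IsPrimitive.antitoneOn_of_nonpos hd fun x hx => ?_
    have hr := (B.areaRadius_mem hx.1).1
    have ha := B.a_pos hx.1
    have h1 := B.areaRadius_mul_a_le hx.1
    have h2 := B.le_areaRadius_mul_a hx.1 (H x hx)
    have h3 : 2 * (k : ℝ) ≤ K * (B.areaRadius x * B.a x) := by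
      calc 2 * (k : ℝ) ≤ 2 * |(k : ℝ)| := by gcongr; exact le_abs_self _
        _ = K * (B.rMinus / 2) := by rw [hK]; field_simp; ring
        _ ≤ _ := by gcongr
    have h4 : 2 * B.offDiag k far x + 3 * (B.a x ^ 2 / B.areaRadius x) - K * B.a x ^ 2
        = (2 * k * B.areaRadius x - 2 * (far * B.momentCoeff)
          + 3 * (B.areaRadius x * B.a x) - K * (B.areaRadius x * B.a x) * B.areaRadius x)
          * B.a x / B.areaRadius x ^ 2 := by
      rw [B.offDiag_eq k far hx.1]
      field_simp
    rw [h4]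
    refine div_nonpos_of_nonpos_of_nonneg (mul_nonpos_of_nonpos_of_nonneg ?_ ha.le)
      (by positivity)
    have := mul_le_mul_of_nonneg_right h3 hr.le
    linarith
  have hb : ∀ x ∈ Ioc 0 δ, B.a x ^ 2 / B.areaRadius x
      ≤ B.meanRadius ^ 2 * Real.exp (-W δ) * Real.exp (2 * B.offDiagPrimitive k far x) := by
    intro x hx
    have hr := (B.areaRadius_mem hx.1).1
    have ha := B.a_pos hx.1
    -- `W x ≥ W δ` turns into the lower bound `exp (2 V) ≥ exp (W δ) / r³`.
    have h1 := hanti hx ⟨hδ, le_rfl⟩ hx.2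
    have h2 : Real.exp (-(3 * Real.log (B.areaRadius x)))
        ≤ Real.exp (-W δ) * Real.exp (2 * B.offDiagPrimitive k far x) := by
      rw [← Real.exp_add, Real.exp_le_exp]
      have : 0 ≤ K * B.areaRadius x := by positivity
      simp only [hW] at h1 ⊢
      linarith
    have h3 : Real.exp (-(3 * Real.log (B.areaRadius x))) = 1 / B.areaRadius x ^ 3 := by
      rw [Real.exp_neg, show (3 : ℝ) * Real.log (B.areaRadius x)
        = ((3 : ℕ) : ℝ) * Real.log (B.areaRadius x) by norm_num, Real.exp_nat_mul,
        Real.exp_log hr, one_div]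
    have h4 : (B.areaRadius x * B.a x) ^ 2 ≤ B.meanRadius ^ 2 :=
      pow_le_pow_left₀ (by positivity) (B.areaRadius_mul_a_le hx.1) 2
    calc B.a x ^ 2 / B.areaRadius x
        = (B.areaRadius x * B.a x) ^ 2 * (1 / B.areaRadius x ^ 3) := by field_simp
      _ ≤ B.meanRadius ^ 2 * (1 / B.areaRadius x ^ 3) := by gcongr
      _ ≤ _ := by
        rw [← h3, mul_assoc]
        gcongr
  have hderiv : ∀ x, 0 < x → deriv (fun x => Real.log (B.areaRadius x)) x
      = B.a x ^ 2 / B.areaRadius x := fun x hx => (B.hasDerivAt_log_areaRadius hx).deriv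
  refine not_integrableOn_of_tendsto_norm_atTop_of_deriv_isBigO_filter
    (f := fun x => Real.log (B.areaRadius x)) (𝓝[>] 0) (Ioc_mem_nhdsGT hε) ?_ ?_ ?_
  · filter_upwards [self_mem_nhdsWithin] with x hx
    exact (B.hasDerivAt_log_areaRadius hx).differentiableAt
  · exact tendsto_abs_atBot_atTop.comp (Real.tendsto_log_nhdsGT_zero.comp B.tendsto_areaRadius)
  · refine Asymptotics.IsBigO.of_bound (B.meanRadius ^ 2 * Real.exp (-W δ)) ?_
    filter_upwards [Ioc_mem_nhdsGT hδ] with x hx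
    have hr := (B.areaRadius_mem hx.1).1
    rw [hderiv x hx.1, Real.norm_of_nonneg (by positivity), Real.norm_of_nonneg (Real.exp_pos _).le]
    exact hb x hx

end BlackHole

/-! ### Numerical value of the threshold -/

namespace PhysicalConstants

variable (C : PhysicalConstants)

lemma farCrit_pos : 0 < C.farCrit := by
  have := C.G_pos
  have := C.hbar_pos
  have := C.c_pos
  have := C.me_pos
  have := C.e_pos
  have := Real.pi_pos
  unfold farCrit muClass
  positivity

/-- Squaring removes `√G` and leaves only the two dimensionless numbers constrained by
`IsEmpirical`. -/
lemma farCrit_sq :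
    C.farCrit ^ 2 * C.alphaS ^ 3 = 36 * Real.pi ^ 2 * (C.G * C.me ^ 2 / (C.hbar * C.c)) := by
  have := C.hbar_pos
  have := C.c_pos
  have := C.me_pos
  have := C.e_pos
  have := Real.pi_pos
  have hG := Real.sq_sqrt C.G_pos.le
  unfold farCrit muClass alphaS
  rw [div_pow, mul_pow, div_pow (Real.sqrt C.G * C.hbar), mul_pow (Real.sqrt C.G), hG]
  field_simp
  ring

/-- The upper end is `1.3e-18` itself, so that every `far ≥ 1.3e-18` lies above the threshold; the
lower end gives the tolerance `0.05e-18`. -/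
lemma farCrit_mem_Ioo_of_isEmpirical (h : C.IsEmpirical) :
    C.farCrit ∈ Ioo (1.25e-18 : ℝ) 1.3e-18 := by
  obtain ⟨⟨hα1, hα2⟩, hg1, hg2⟩ := h
  have hsq := C.farCrit_sq
  have hpos := C.farCrit_pos
  have hπ1 := Real.pi_gt_d4
  have hπ2 := Real.pi_lt_d4
  set α := C.alphaS
  set g := C.G * C.me ^ 2 / (C.hbar * C.c)
  set F := C.farCrit
  have hα0 : 0 < α := lt_of_lt_of_le (by norm_num) hα1
  have hA1 : (1 / 137.04 : ℝ) ^ 3 ≤ α ^ 3 := by gcongr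
  have hA2 : α ^ 3 ≤ (1 / 137.03 : ℝ) ^ 3 := by gcongr
  have hP1 : (3.1415 : ℝ) ^ 2 ≤ Real.pi ^ 2 := by gcongr
  have hP2 : Real.pi ^ 2 ≤ (3.1416 : ℝ) ^ 2 := by gcongr
  constructor
  · by_contra! hF
    have h1 : F ^ 2 * α ^ 3 ≤ (1.25e-18 : ℝ) ^ 2 * (1 / 137.03 : ℝ) ^ 3 := by gcongr
    have h2 : 36 * (3.1415 : ℝ) ^ 2 * 1.75e-45 ≤ 36 * Real.pi ^ 2 * g := by gcongr
    have h3 := (h2.trans_eq hsq.symm).trans h1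
    norm_num at h3
  · by_contra! hF
    have h1 : (1.3e-18 : ℝ) ^ 2 * (1 / 137.04 : ℝ) ^ 3 ≤ F ^ 2 * α ^ 3 := by gcongr
    have h2 : 36 * Real.pi ^ 2 * g ≤ 36 * (3.1416 : ℝ) ^ 2 * 1.8e-45 := by gcongr
    have h3 := (h1.trans_eq hsq).trans h2
    norm_num at h3

end PhysicalConstants

end RWN

/-! ### The Lagrange identity and the adjoint operator -/

lemma IsPrimitive.setIntegral_Ioi_eq_zero {u p : ℝ → ℂ} (h : IsPrimitive u p)
    (hp : IntegrableOn p (Ioi 0)) (h0 : Tendsto u (𝓝[>] 0) (𝓝 0))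
    (h1 : Tendsto u atTop (𝓝 0)) : ∫ x in Ioi (0 : ℝ), p x = 0 := by
  have hp0 : IntegrableOn p (Ioc 0 1) := hp.mono_set Ioc_subset_Ioi_self
  have hp1 : IntegrableOn p (Ioi 1) := hp.mono_set (Ioi_subset_Ioi zero_le_one)
  obtain ⟨L, hL⟩ := h.exists_eq_add_integral one_pos hp0
  have hlim : Tendsto u (𝓝[>] 0) (𝓝 L) := by
    have := (tendsto_intervalIntegral_zero one_pos hp0).const_add L
    rw [add_zero] at this
    refine this.congr' ?_
    filter_upwards [Ioc_mem_nhdsGT one_pos] with x hx using (hL x hx).symm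
  have hL0 : L = 0 := tendsto_nhds_unique hlim h0
  have hlim1 : Tendsto u atTop (𝓝 (u 1 + ∫ t in Ioi (1 : ℝ), p t)) := by
    refine Tendsto.congr' ?_ ((intervalIntegral_tendsto_integral_Ioi 1 hp1 tendsto_id).const_add _)
    filter_upwards [eventually_gt_atTop 0] with x hx
    exact (h.eq_add one_pos hx).symm
  have e := tendsto_nhds_unique hlim1 h1
  rw [hL 1 ⟨one_pos, le_rfl⟩, hL0, zero_add, intervalIntegral.integral_of_le zero_le_one] at e
  rw [← Ioc_union_Ioi_eq_Ioi zero_le_one, setIntegral_union Ioc_disjoint_Ioi_same measurableSet_Ioi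
    hp0 hp1, e]

lemma IsHalfLineTest.deriv {χ : ℝ → ℝ} (h : IsHalfLineTest χ) : IsHalfLineTest (deriv χ) where
  contDiff := (contDiff_infty_iff_deriv.1 h.contDiff).2
  hasCompactSupport := h.hasCompactSupport.deriv
  tsupport_subset := (closure_minimal support_deriv_subset (isClosed_tsupport _)).trans
    h.tsupport_subset

namespace RWN

/-- The spinor valued test function with `i`-th component `χ`. -/
noncomputable def spinorTest {χ : ℝ → ℝ} (h : IsHalfLineTest χ) (i : Fin 2) : RadialTestFunction where
  toFun x := χ x • EuclideanSpace.single i (1 : ℂ)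
  contDiff' := h.contDiff.smul contDiff_const
  hasCompactSupport' := h.hasCompactSupport.smul_right
  tsupport_subset' := (tsupport_smul_subset_left _ _).trans h.tsupport_subset

lemma spinorTest_apply {χ : ℝ → ℝ} (h : IsHalfLineTest χ) (i : Fin 2) (x : ℝ) :
    spinorTest h i x = χ x • EuclideanSpace.single i (1 : ℂ) := rfl

lemma deriv_spinorTest {χ : ℝ → ℝ} (h : IsHalfLineTest χ) (i : Fin 2) (x : ℝ) :
    deriv (spinorTest h i) x = deriv χ x • EuclideanSpace.single i (1 : ℂ) :=
  ((h.hasDerivAt x).smul_const _).deriv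

lemma spinor_inner (x y : Spinor) :
    inner ℂ x y = starRingEnd ℂ (x 0) * y 0 + starRingEnd ℂ (x 1) * y 1 := by
  simp [PiLp.inner_apply, Fin.sum_univ_two, mul_comm]

lemma memLp_component (g : RadialHilbertSpace) (i : Fin 2) :
    MemLp (fun x => g x i) 2 (volume.restrict (Ioi (0 : ℝ))) :=
  (EuclideanSpace.proj i : Spinor →L[ℂ] ℂ).comp_memLp' (Lp.memLp g)

lemma locallyIntegrableOn_component (g : RadialHilbertSpace) (i : Fin 2) :
    LocallyIntegrableOn (fun x => g x i) (Ioi 0) :=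
  locallyIntegrableOn_of_locallyIntegrable_restrict
    ((memLp_component g i).locallyIntegrable one_le_two)

lemma coeFn_testToL2 (φ : RadialTestFunction) :
    testToL2 φ =ᵐ[volume.restrict (Ioi (0 : ℝ))] φ := (memLp_test φ).coeFn_toLp

/-- A vector orthogonal to all test functions vanishes, by testing each component separately. -/
lemma dense_range_testToL2 : Dense (LinearMap.range testToL2 : Set RadialHilbertSpace) := by
  rw [Submodule.dense_iff_topologicalClosure_eq_top, Submodule.topologicalClosure_eq_top_iff,
    Submodule.eq_bot_iff]
  intro g hg
  rw [Submodule.mem_orthogonal] at hg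
  have hz : ∀ i : Fin 2, ∀ᵐ x : ℝ, x ∈ Ioi (0 : ℝ) → g x i = 0 := by
    intro i
    refine isOpen_Ioi.ae_eq_zero_of_integral_contDiff_smul_eq_zero
      (locallyIntegrableOn_component g i) fun χ h1 h2 h3 => ?_
    have hχ : IsHalfLineTest χ := ⟨h1, h2, h3⟩
    have e := hg _ (LinearMap.mem_range_self testToL2 (spinorTest hχ i))
    rw [L2.inner_def] at e
    rw [← setIntegral_eq_integral_of_forall_compl_eq_zero (s := Ioi 0) fun x hx => by
      rw [image_eq_zero_of_notMem_tsupport fun h => hx (h3 h), zero_smul], ← e]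
    refine integral_congr_ae ?_
    filter_upwards [coeFn_testToL2 (spinorTest hχ i)] with x hx
    rw [hx, spinor_inner, spinorTest_apply]
    fin_cases i <;> simp
  rw [Lp.eq_zero_iff_ae_eq_zero, EventuallyEq, ae_restrict_iff' measurableSet_Ioi]
  filter_upwards [hz 0, hz 1] with x h0 h1 hx
  ext i
  fin_cases i
  · exact h0 hx
  · exact h1 hx

namespace BlackHole

variable {C : PhysicalConstants} (B : BlackHole C)

/-- `g` is locally absolutely continuous on `(0, ∞)` and the Dirac expression maps it to `w`. -/
structure IsDiracPair (k : ℤ) (far : ℝ) (g w : ℝ → Spinor) : Prop where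
  upper : IsPrimitive (fun x => g x 0) (fun x =>
    w x 1 - B.offDiag k far x * g x 0 + ((B.a x : ℂ) + B.b x) * g x 1)
  lower : IsPrimitive (fun x => g x 1) (fun x =>
    ((B.a x : ℂ) - B.b x) * g x 0 + B.offDiag k far x * g x 1 - w x 0)

variable {B} {k : ℤ} {far : ℝ}

/-- The Lagrange identity. -/
lemma IsDiracPair.lagrange {g w h z : ℝ → Spinor} (hg : B.IsDiracPair k far g w)
    (hh : B.IsDiracPair k far h z) :
    IsPrimitive (fun x => starRingEnd ℂ (g x 0) * h x 1 - starRingEnd ℂ (g x 1) * h x 0)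
      (fun x => inner ℂ (w x) (h x) - inner ℂ (g x) (z x)) := by
  refine ((hg.upper.conj.mul hh.lower).sub (hg.lower.conj.mul hh.upper)).congr_right
    (ae_of_all _ fun x _ => ?_)
  -- The coefficients are real, so all terms containing them cancel.
  simp only [spinor_inner, map_add, map_sub, map_mul, Complex.conj_ofReal]
  ring

lemma isDiracPair_test (φ : RadialTestFunction) :
    B.IsDiracPair k far φ (B.diracExpr k far φ) := by
  have hd : ∀ (i : Fin 2) (x : ℝ), HasDerivAt (fun x => φ x i) (deriv φ x i) x := fun i x =>
    ((EuclideanSpace.proj i : Spinor →L[ℂ] ℂ).restrictScalars ℝ).hasFDerivAt.comp_hasDerivAt x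
      (φ.contDiff.differentiable (by simp) x).hasDerivAt
  have hp : ∀ i : Fin 2, IsPrimitive (fun x => φ x i) (fun x => deriv φ x i) := fun i =>
    .of_hasDerivAt (fun x _ => hd i x)
      ((PiLp.continuous_apply 2 _ i).comp (continuous_deriv_test φ)).continuousOn
  constructor
  · refine (hp 0).congr_right (ae_of_all _ fun x _ => ?_)
    simp [diracExpr, offDiag]
    ring
  · refine (hp 1).congr_right (ae_of_all _ fun x _ => ?_)
    simp [diracExpr, offDiag]

lemma coeFn_diracOnTest (φ : RadialTestFunction) :
    B.diracOnTest k far φ =ᵐ[volume.restrict (Ioi (0 : ℝ))] B.diracExpr k far φ :=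
  (B.memLp_diracExpr k far φ).coeFn_toLp

/-- The boundary form of two test functions vanishes near `0` and near `∞`. -/
lemma inner_diracOnTest (φ ψ : RadialTestFunction) :
    inner ℂ (B.diracOnTest k far φ) (testToL2 ψ)
      = inner ℂ (testToL2 φ) (B.diracOnTest k far ψ) := by
  rw [← sub_eq_zero, L2.inner_def, L2.inner_def,
    ← integral_sub (L2.integrable_inner _ _) (L2.integrable_inner _ _)]
  have hae : (fun x => inner ℂ (B.diracOnTest k far φ x) (testToL2 ψ x)
      - inner ℂ (testToL2 φ x) (B.diracOnTest k far ψ x)) =ᵐ[volume.restrict (Ioi (0 : ℝ))]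
      fun x => inner ℂ (B.diracExpr k far φ x) (ψ x) - inner ℂ (φ x) (B.diracExpr k far ψ x) := by
    filter_upwards [coeFn_testToL2 φ, coeFn_testToL2 ψ, coeFn_diracOnTest (k := k) (far := far) φ,
      coeFn_diracOnTest (k := k) (far := far) ψ] with x h1 h2 h3 h4
    rw [h1, h2, h3, h4]
  have hint := ((L2.integrable_inner (𝕜 := ℂ) (B.diracOnTest k far φ) (testToL2 ψ)).sub
    (L2.integrable_inner (𝕜 := ℂ) (testToL2 φ) (B.diracOnTest k far ψ))).congr hae
  rw [integral_congr_ae hae]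
  obtain ⟨α, β, hα, hαβ, hs⟩ :=
    φ.hasCompactSupport.exists_subset_Ioo_of_subset_Ioi φ.tsupport_subset
  have hφ : ∀ x, x ∉ Ioo α β → φ x = 0 := fun x hx =>
    image_eq_zero_of_notMem_tsupport fun h => hx (hs h)
  refine ((isDiracPair_test φ).lagrange (isDiracPair_test ψ)).setIntegral_Ioi_eq_zero hint ?_ ?_
  · refine tendsto_const_nhds.congr' ?_
    filter_upwards [Ioo_mem_nhdsGT hα] with x hx
    simp [hφ x fun h => absurd hx.2 (not_lt.2 h.1.le)]
  · refine tendsto_const_nhds.congr' ?_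
    filter_upwards [eventually_ge_atTop β] with x hx
    simp [hφ x fun h => absurd hx (not_le.2 h.2)]

lemma dense_Ktilde_domain : Dense ((Ktilde B k far).domain : Set RadialHilbertSpace) :=
  dense_range_testToL2

lemma Ktilde_isFormalAdjoint : (Ktilde B k far).IsFormalAdjoint (Ktilde B k far) := by
  rintro ⟨_, φ, rfl⟩ ⟨_, ψ, rfl⟩
  rw [Ktilde_apply, Ktilde_apply]
  exact inner_diracOnTest φ ψ

lemma continuousOn_ofReal_Ioi {f : ℝ → ℝ} (h : ∀ x, 0 < x → ContinuousAt f x) :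
    ContinuousOn (fun x => (f x : ℂ)) (Ioi 0) := fun x hx =>
  (Complex.continuous_ofReal.continuousAt.comp (h x hx)).continuousWithinAt

/-- Elements of the domain of the adjoint have locally absolutely continuous representatives, on
which the adjoint acts by the Dirac expression. -/
lemma exists_isDiracPair_of_adjoint (g : (Ktilde B k far).adjoint.domain) :
    ∃ u : ℝ → Spinor, (g : RadialHilbertSpace) =ᵐ[volume.restrict (Ioi (0 : ℝ))] u ∧
      B.IsDiracPair k far u ((Ktilde B k far).adjoint g) := by
  set w := (Ktilde B k far).adjoint g
  have hweak : ∀ φ : RadialTestFunction,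
      ∫ x in Ioi (0 : ℝ), (inner ℂ (B.diracExpr k far φ x) ((g : RadialHilbertSpace) x)
        - inner ℂ (φ x) (w x)) = 0 := by
    intro φ
    have h1 := (LinearPMap.adjoint_isFormalAdjoint (dense_Ktilde_domain (B := B) (k := k)
      (far := far))).symm ⟨testToL2 φ, LinearMap.mem_range_self _ φ⟩ g
    rw [Ktilde_apply, ← sub_eq_zero, L2.inner_def, L2.inner_def,
      ← integral_sub (L2.integrable_inner _ _) (L2.integrable_inner _ _)] at h1
    rw [← h1]
    refine integral_congr_ae ?_
    filter_upwards [coeFn_testToL2 φ, coeFn_diracOnTest (k := k) (far := far) φ] with x h2 h3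
    rw [h2, h3]
  have hl := locallyIntegrableOn_component (g : RadialHilbertSpace)
  have hlw := locallyIntegrableOn_component w
  have hca : ContinuousOn (fun x => (B.a x : ℂ)) (Ioi 0) :=
    continuousOn_ofReal_Ioi fun x hx => B.continuousAt_a hx
  have hcb : ContinuousOn (fun x => (B.b x : ℂ)) (Ioi 0) :=
    continuousOn_ofReal_Ioi fun x hx => B.continuousAt_b hx
  have hcv : ContinuousOn (fun x => (B.offDiag k far x : ℂ)) (Ioi 0) :=
    Complex.continuous_ofReal.comp_continuousOn (B.continuousOn_offDiag k far)
  have hopen := (isOpen_Ioi (a := (0 : ℝ))).isLocallyClosed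
  have hp0 : LocallyIntegrableOn (fun x => w x 1 - B.offDiag k far x * (g : RadialHilbertSpace) x 0
      + ((B.a x : ℂ) + B.b x) * (g : RadialHilbertSpace) x 1) (Ioi 0) :=
    ((hlw 1).sub ((hl 0).continuousOn_mul hcv hopen)).add ((hl 1).continuousOn_mul (hca.add hcb) hopen)
  have hp1 : LocallyIntegrableOn (fun x => ((B.a x : ℂ) - B.b x) * (g : RadialHilbertSpace) x 0
      + B.offDiag k far x * (g : RadialHilbertSpace) x 1 - w x 0) (Ioi 0) :=
    (((hl 0).continuousOn_mul (hca.sub hcb) hopen).add ((hl 1).continuousOn_mul hcv hopen)).sub (hlw 0)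
  -- The derivative crosses components: testing with the second basis vector yields the equation for
  -- the first component, and vice versa.
  obtain ⟨u₀, hu₀, he₀⟩ := exists_isPrimitive_of_weak_deriv (hl 0) hp0 fun χ hχ => by
    rw [eq_neg_iff_add_eq_zero, ← integral_add (hχ.deriv.integrableOn_smul (hl 0))
      (hχ.integrableOn_smul hp0), ← neg_eq_zero, ← integral_neg, ← hweak (spinorTest hχ 1)]
    refine integral_congr_ae (ae_of_all _ fun x => ?_)
    simp [spinor_inner, diracExpr, deriv_spinorTest, spinorTest_apply, offDiag]
    ring
  obtain ⟨u₁, hu₁, he₁⟩ := exists_isPrimitive_of_weak_deriv (hl 1) hp1 fun χ hχ => by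
    rw [eq_neg_iff_add_eq_zero, ← integral_add (hχ.deriv.integrableOn_smul (hl 1))
      (hχ.integrableOn_smul hp1), ← hweak (spinorTest hχ 0)]
    refine integral_congr_ae (ae_of_all _ fun x => ?_)
    simp [spinor_inner, diracExpr, deriv_spinorTest, spinorTest_apply, offDiag]
    ring
  refine ⟨fun x => !₂[u₀ x, u₁ x], ?_, ?_, ?_⟩
  · rw [EventuallyEq, ae_restrict_iff' measurableSet_Ioi]
    filter_upwards [he₀, he₁] with x h0 h1 hx
    ext i
    fin_cases i
    · exact h0 hx
    · exact h1 hx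
  -- The right-hand side still contains the `L²` representative, which may be replaced by `u` off a
  -- null set.
  · refine hu₀.congr_right ?_
    filter_upwards [he₀, he₁] with x h0 h1 hx
    simp [h0 hx, h1 hx]
  · refine hu₁.congr_right ?_
    filter_upwards [he₀, he₁] with x h0 h1 hx
    simp [h0 hx, h1 hx]

/-- The defect of symmetry is the integral of the derivative of the boundary form, which vanishes at
both ends. -/
lemma Ktilde_adjoint_isFormalAdjoint (hfar : C.farCrit ≤ far) :
    (Ktilde B k far).adjoint.IsFormalAdjoint (Ktilde B k far).adjoint := by
  intro g h
  obtain ⟨u, hgu, hu⟩ := exists_isDiracPair_of_adjoint g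
  obtain ⟨y, hhy, hy⟩ := exists_isDiracPair_of_adjoint h
  set w := (Ktilde B k far).adjoint g
  set z := (Ktilde B k far).adjoint h
  obtain ⟨δ, hδ, H⟩ := B.exists_offDiag_nonpos k hfar
  have hmem : ∀ (f : RadialHilbertSpace) (s : ℝ → Spinor) (i : Fin 2),
      f =ᵐ[volume.restrict (Ioi (0 : ℝ))] s →
      MemLp (fun x => s x i) 2 (volume.restrict (Ioi (0 : ℝ))) := fun f s i hfs =>
    (memLp_component f i).ae_eq (by filter_upwards [hfs] with x hx; rw [hx])
  have hbdry : ∀ (f f' : RadialHilbertSpace) (s : ℝ → Spinor),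
      f =ᵐ[volume.restrict (Ioi (0 : ℝ))] s → B.IsDiracPair k far s f' →
      Tendsto (fun x => s x 1) (𝓝[>] 0) (𝓝 0) ∧ ∃ K, ∀ x ∈ Ioc 0 δ, ‖s x 0‖ ≤ K := by
    intro f f' s hfs hs
    have hle : volume.restrict (Ioc 0 δ) ≤ volume.restrict (Ioi (0 : ℝ)) :=
      Measure.restrict_mono Ioc_subset_Ioi_self le_rfl
    exact tendsto_zero_and_exists_bound_of_dirac_system hδ
      (fun x hx => B.hasDerivAt_offDiagPrimitive k far hx) (B.continuousOn_offDiag k far)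
      (fun x hx => (H x hx).2) (fun ε hε => B.not_integrableOn_exp_offDiagPrimitive k hfar hε)
      (B.memLp_a δ) (B.memLp_b fun x hx => (H x hx).1)
      ((hmem f s 0 hfs).mono_measure hle) ((hmem f s 1 hfs).mono_measure hle)
      ((memLp_component f' 0).mono_measure hle) ((memLp_component f' 1).mono_measure hle)
      hs.upper hs.lower
  obtain ⟨hu1, K, hK⟩ := hbdry g w u hgu hu
  obtain ⟨hy1, K', hK'⟩ := hbdry h z y hhy hy
  have hW := hu.lagrange hy
  have hae : (fun x => inner ℂ (w x) ((h : RadialHilbertSpace) x)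
      - inner ℂ ((g : RadialHilbertSpace) x) (z x)) =ᵐ[volume.restrict (Ioi (0 : ℝ))]
      fun x => inner ℂ (w x) (y x) - inner ℂ (u x) (z x) := by
    filter_upwards [hgu, hhy] with x h1 h2
    rw [h1, h2]
  have hint := ((L2.integrable_inner (𝕜 := ℂ) w (h : RadialHilbertSpace)).sub
    (L2.integrable_inner (𝕜 := ℂ) (g : RadialHilbertSpace) z)).congr hae
  rw [← sub_eq_zero, L2.inner_def, L2.inner_def,
    ← integral_sub (L2.integrable_inner _ _) (L2.integrable_inner _ _), integral_congr_ae hae]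
  refine hW.setIntegral_Ioi_eq_zero hint ?_ ?_
  -- At `0` each product in the form pairs a bounded first component with a second component tending
  -- to zero.
  · have hlim : Tendsto (fun x => K * ‖y x 1‖ + ‖u x 1‖ * K') (𝓝[>] 0) (𝓝 0) := by
      have := (hy1.norm.const_mul K).add (hu1.norm.mul_const K')
      simpa using this
    refine squeeze_zero_norm' ?_ hlim
    filter_upwards [Ioc_mem_nhdsGT hδ] with x hx
    refine (norm_sub_le _ _).trans ?_
    rw [norm_mul, norm_mul, RCLike.norm_conj, RCLike.norm_conj]
    gcongr
    · exact hK x hx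
    · exact hK' x hx
  -- At `∞` the behaviour of the coefficients plays no role: the form is a combination of products
  -- of `L²` functions, and its derivative is integrable by `hint`.
  · refine hW.tendsto_atTop_zero (hint.mono_measure
      (Measure.restrict_mono (Ioi_subset_Ioi zero_le_one) le_rfl)) ?_
    have hW1 : IntegrableOn (fun x => starRingEnd ℂ (u x 0) * y x 1
        - starRingEnd ℂ (u x 1) * y x 0) (Ioi 0) :=
      ((hmem g u 0 hgu).star.integrable_mul (hmem h y 1 hhy)).sub
        ((hmem g u 1 hgu).star.integrable_mul (hmem h y 0 hhy))
    exact hW1.mono_set (Ioi_subset_Ioi zero_le_one)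

theorem Ktilde_isEssentiallySelfAdjoint (hfar : C.farCrit ≤ far) :
    IsEssentiallySelfAdjoint (Ktilde B k far) :=
  LinearPMap.isEssentiallySelfAdjoint_of_adjoint_symmetric dense_Ktilde_domain
    Ktilde_isFormalAdjoint (Ktilde_adjoint_isFormalAdjoint hfar)

end BlackHole

end RWN

theorem mainTheorem12 (C : RWN.PhysicalConstants) (B : RWN.BlackHole C) (k : ℤ) (hk : k ≠ 0) :
    (∀ far : ℝ, C.farCrit ≤ far → RWN.IsEssentiallySelfAdjoint (RWN.Ktilde B k far)) ∧
    (C.IsEmpirical →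
      |C.farCrit - 1.3e-18| < 0.05e-18 ∧
      (∀ far : ℝ, 1.3e-18 ≤ far → RWN.IsEssentiallySelfAdjoint (RWN.Ktilde B k far)) ∧
      (∀ far : ℝ, |far - 1| ≤ 0.005 → RWN.IsEssentiallySelfAdjoint (RWN.Ktilde B k far))) := by
  refine ⟨fun far h => RWN.BlackHole.Ktilde_isEssentiallySelfAdjoint h, fun hC => ?_⟩
  obtain ⟨h1, h2⟩ := C.farCrit_mem_Ioo_of_isEmpirical hC
  refine ⟨?_, fun far h => RWN.BlackHole.Ktilde_isEssentiallySelfAdjoint (h2.le.trans h),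
    fun far h => RWN.BlackHole.Ktilde_isEssentiallySelfAdjoint (h2.le.trans ?_)⟩
  · rw [abs_lt]
    constructor <;> norm_num at h1 h2 ⊢ <;> linarith
  · have := (abs_le.1 h).1
    norm_num at this ⊢
    linarith
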